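/- **Theorem (Skinny Lipschitz tube decomposition).** For every dimension $d$ there are constants $r, V, C > 0$, depending only on $d$, with the following property. Let $u\in C(\mathbb{R};L^2(\mathbb{R}^d))$ be a solution of the free Schrödinger equation $i\partial_t u+\Delta u=0$ on $\mathbb{R}^d\times\mathbb{R}$ (in the sense of tempered distributions in $x$: $\frac{d}{dt}\int u_t\psi\,dx=i\int u_t\,\Delta\psi\,dx$ for every Schwartz function $\psi$ and every $t$), with initial value $u_0\in L^2(\mathbb{R}^d)$ whose Fourier transform $\widehat{u_0}(\xi)=\int e^{-ix\cdot\xi}u_0(x)\,dx$ is supported in the closed unit ball; write $u_t(x)=u(x,t)$ and take $u_t$ to be its continuous representative for each $t$. Then for every $R>0$ there are a countable family of differentiable paths $\gamma_i:\mathbb{R}\to\mathbb{R}^d$ with $|\gamma_i'(t)|\le V$ for all $t$, and weights $w_i\ge 0$ with $\sum_i w_i<\infty$, such that $$|u_t(x)|^2\le\sum_i w_i\,\mathbf 1_{T_{\gamma_i,r}}(x,t)\qquad\text{for all }(x,t)\in\mathbb{R}^d\times[-R,R],$$ where $T_{\gamma,r}=\{(x,t)\in\mathbb{R}^d\times\mathbb{R}:\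 |x-\gamma(t)|\le r\}$, and moreover $$\sum_i r^d w_i\le C\int_{\mathbb{R}^d}|u_t(x)|^2\,dx\qquad\text{for every }t\in\mathbb{R}.$$ (The right-hand side does not depend on $t$; for $t=0$ it is $C\|u_0\|_{L^2}^2$.) -/

import Mathlib

open MeasureTheory

open scoped SchwartzMap FourierTransform Laplacian

/-- `u : ℝ → ℝᵈ → ℂ` (time first) is an `L²` solution of the free Schrödinger equation
`i ∂ₜ u + Δ u = 0` on all of `ℝ × ℝᵈ`: it belongs to `C(ℝ; L²(ℝᵈ))` and the equation holds in the
sense of tempered distributions at every time,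
`d/dt ∫ uₜ ψ = i ∫ uₜ Δψ` for every Schwartz function `ψ`. -/
structure IsSchrodingerSolution {d : ℕ} (u : ℝ → EuclideanSpace ℝ (Fin d) → ℂ) : Prop where
  memLp : ∀ t : ℝ, MemLp (u t) 2 volume
  continuous_toLp : Continuous fun t : ℝ => (memLp t).toLp (u t)
  equation : ∀ (ψ : 𝓢(EuclideanSpace ℝ (Fin d), ℂ)) (t : ℝ),
    HasDerivAt (fun s : ℝ => ∫ x, u s x * ψ x) (Complex.I * ∫ x, u t x * (Δ ψ) x) t

/-- For `S` closed, the Fourier transform of `f ∈ L²(ℝᵈ)` is supported in `S`, where the Fourier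
transform is `f̂(ξ) = ∫ e^{-i x·ξ} f(x) dx`. Mathlib's `𝓕` has the phase `e^{-2πi x·η}`, so that
`f̂(2πη) = 𝓕 f η`. -/
def HasFourierSupportIn {d : ℕ} (f : EuclideanSpace ℝ (Fin d) → ℂ) (hf : MemLp f 2 volume)
    (S : Set (EuclideanSpace ℝ (Fin d))) : Prop :=
  ∀ᵐ η : EuclideanSpace ℝ (Fin d), (2 * Real.pi) • η ∉ S → 𝓕 (hf.toLp f) η = 0

/-- `γ` is a differentiable path of speed at most `V`. -/
def IsPathOfSpeedAtMost {d : ℕ} (γ : ℝ → EuclideanSpace ℝ (Fin d)) (V : ℝ) : Prop :=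
  Differentiable ℝ γ ∧ ∀ t : ℝ, ‖deriv γ t‖ ≤ V

/-- The space-time tube of width `r` centred at the path `γ`. -/
def tube {d : ℕ} (γ : ℝ → EuclideanSpace ℝ (Fin d)) (r : ℝ) :
    Set (EuclideanSpace ℝ (Fin d) × ℝ) :=
  {p | ‖p.1 - γ p.2‖ ≤ r}

/-! The mass density `|u|²` obeys a continuity equation with current `2 Im(ū ∇u)`, so one would like
to let the mass flow along paths and use these as the tubes. The pointwise velocity, current over
density, can blow up near zeros of `u`. Both quantities are therefore averaged against the slowly
varying weight `(1 + |z|)^{-(d+1)}`, which is integrable and changes under translation by `w` by a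
factor at most `(1 + |w|)^{d+1}`. Averaging preserves the continuity equation. Since `u` is
band-limited, `u` and `∂ⱼu` are convolutions of `u` with fixed Schwartz functions, whose decay
absorbs the translation loss. Hence the averaged density `ρ` satisfies `∑ⱼ |Jⱼ| ≤ V ρ` and `|u|² ≤ C
ρ`, with constants depending only on `d` (`exists_waveDensity_bounds`).

A current bounded by `V ρ` means finite speed: the `ρ`-mass of a bounded set `S` at one time is at
most the mass of its `L`-thickening at any time within one unit later
(`integral_le_of_continuity_equation`). For the masses of the unit grid cubes at consecutive integer
steps this is exactly Hall's condition. The marriage theorem, in a fractional form, then gives a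
transport plan moving mass only between nearby cubes; conservation of total mass makes both
marginals exact (`exists_coupling`).

Composing the plans as a Markov chain yields countably many weighted discrete paths
(`exists_weighted_paths`), smoothed into differentiable ones of bounded speed. Near a point `(x,
t)`, `|u|²` is controlled by the `ρ`-mass of a unit ball; by the next grid time that mass lies in
cubes near `x`, and the paths through those cubes stayed near `x` at time `t`. The total weight is a
multiple of the total `ρ`-mass, hence of `‖u₀‖²`.

It remains to connect the weak equation with explicit plane waves: on the Fourier side the solution
is multiplied by a unimodular phase (`IsSchrodingerSolution.fourier_ae_eq`). -/

/-! ### Fractional matching and gluing of couplings -/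

/-- Integral form of the fractional marriage theorem: after scaling by `M` and rounding, the demand
`a` can be matched into the supply `b` along the relation `N`. -/
theorem exists_rounded_coupling {α β : Type*} [DecidableEq β] (a : α → ℝ) (b : β → ℝ)
    (ha : ∀ x, 0 ≤ a x) (N : α → Finset β)
    (hall : ∀ A : Finset α, ∑ x ∈ A, a x ≤ ∑ y ∈ A.biUnion N, b y) (M : ℕ) :
    ∃ p : α → β → ℕ, (∀ x y, y ∉ N x → p x y = 0) ∧
      (∀ x, ∑ y ∈ N x, p x y = ⌊M * a x⌋₊) ∧
      ∀ (F : Finset α) (y : β), ∑ x ∈ F, p x y ≤ ⌈M * b y⌉₊ := by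
  classical
  let t : (Σ x : α, Fin ⌊M * a x⌋₊) → Finset (Σ y : β, Fin ⌈M * b y⌉₊) :=
    fun z => (N z.1).sigma fun _ => Finset.univ
  have key : ∀ s : Finset (Σ x : α, Fin ⌊M * a x⌋₊), s.card ≤ (s.biUnion t).card := by
    intro s
    set A := s.image Sigma.fst with hA
    have h1 : s ⊆ A.sigma fun _ => Finset.univ := by
      intro z hz
      simp only [Finset.mem_sigma, Finset.mem_univ, and_true, hA]
      exact Finset.mem_image_of_mem _ hz
    have h2 : s.biUnion t = (A.biUnion N).sigma fun _ => Finset.univ := by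
      ext z
      simp only [Finset.mem_biUnion, t, Finset.mem_sigma, Finset.mem_univ, and_true, hA,
        Finset.mem_image]
      constructor
      · rintro ⟨w, hw, hz⟩
        exact ⟨w.1, ⟨w, hw, rfl⟩, hz⟩
      · rintro ⟨_, ⟨w, hw, rfl⟩, hz⟩
        exact ⟨w, hw, hz⟩
    refine (Finset.card_le_card h1).trans ?_
    rw [h2, Finset.card_sigma, Finset.card_sigma]
    simp only [Finset.card_univ, Fintype.card_fin]
    have h3 : (∑ x ∈ A, (⌊M * a x⌋₊ : ℝ)) ≤ ∑ y ∈ A.biUnion N, (⌈M * b y⌉₊ : ℝ) :=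
      calc (∑ x ∈ A, (⌊M * a x⌋₊ : ℝ)) ≤ ∑ x ∈ A, M * a x :=
            Finset.sum_le_sum fun x _ => Nat.floor_le (mul_nonneg M.cast_nonneg (ha x))
        _ ≤ ∑ y ∈ A.biUnion N, M * b y := by
            rw [← Finset.mul_sum, ← Finset.mul_sum]
            exact mul_le_mul_of_nonneg_left (hall A) M.cast_nonneg
        _ ≤ _ := Finset.sum_le_sum fun y _ => Nat.le_ceil _
    exact_mod_cast h3
  -- Hall's theorem for an arbitrary index set with finite neighbourhoods, applied to `⌊M a x⌋`
  -- copies of each `x` and `⌈M b y⌉` copies of each `y`. The rounding directions make the counting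
  -- inequality follow from `hall`.
  obtain ⟨f, hf, hft⟩ := (Finset.all_card_le_biUnion_card_iff_exists_injective t).1 key
  have hfN : ∀ z, (f z).1 ∈ N z.1 := fun z => (Finset.mem_sigma.1 (hft z)).1
  refine ⟨fun x y => (Finset.univ.filter fun i => (f ⟨x, i⟩).1 = y).card, ?_, ?_, ?_⟩
  · intro x y hy
    rw [Finset.card_eq_zero, Finset.filter_eq_empty_iff]
    rintro i - rfl
    exact hy (hfN _)
  · intro x
    rw [← Finset.card_eq_sum_card_fiberwise fun i _ => hfN ⟨x, i⟩]
    simp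
  · intro F y
    rw [← Finset.card_sigma]
    have : (F.sigma fun x => Finset.univ.filter fun i => (f ⟨x, i⟩).1 = y).card ≤
        (({y} : Finset β).sigma fun y => (Finset.univ : Finset (Fin ⌈M * b y⌉₊))).card := by
      refine Finset.card_le_card_of_injOn f ?_ hf.injOn
      intro z hz
      simp only [Finset.coe_sigma, Finset.coe_filter, Finset.mem_univ, true_and] at hz
      simp only [Finset.coe_sigma, Set.mem_sigma_iff, Finset.coe_singleton, Finset.coe_univ,
        Set.mem_univ, and_true, Set.mem_singleton_iff]
      exact hz.2
    simpa [Finset.card_sigma] using this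

/-- Fractional marriage theorem, for locally finite relations. -/
theorem exists_fractional_matching {α β : Type*} [DecidableEq β] (a : α → ℝ) (b : β → ℝ)
    (ha : ∀ x, 0 ≤ a x) (hb : ∀ y, 0 ≤ b y) (N : α → Finset β)
    (hall : ∀ A : Finset α, ∑ x ∈ A, a x ≤ ∑ y ∈ A.biUnion N, b y) :
    ∃ p : α → β → ℝ, (∀ x y, 0 ≤ p x y) ∧ (∀ x y, y ∉ N x → p x y = 0) ∧
      (∀ x, ∑ y ∈ N x, p x y = a x) ∧
      ∀ (F : Finset α) (y : β), ∑ x ∈ F, p x y ≤ b y := by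
  choose q hqN hqrow hqcol using exists_rounded_coupling a b ha N hall
  -- A limit along an ultrafilter makes all the bounded entries `q M x y / M` converge at once, with
  -- no diagonal extraction. Only finite sums are passed to the limit: rows live on `N x`, columns
  -- are tested on finite `F`.
  let U : Filter ℕ := (Filter.hyperfilter ℕ : Ultrafilter ℕ)
  have hU : U ≤ Filter.atTop := Filter.hyperfilter_le_cofinite.trans Nat.cofinite_eq_atTop.le
  have hbd : ∀ x y M, (q M x y / M : ℝ) ∈ Set.Icc 0 (a x) := by
    intro x y M
    refine ⟨by positivity, ?_⟩
    have h1 : q M x y ≤ ⌊M * a x⌋₊ := by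
      by_cases hy : y ∈ N x
      · rw [← hqrow M x]
        exact Finset.single_le_sum (f := fun y => q M x y) (fun _ _ => Nat.zero_le _) hy
      · rw [hqN M x y hy]; exact Nat.zero_le _
    have h2 : (q M x y : ℝ) ≤ M * a x :=
      (Nat.cast_le.2 h1).trans (Nat.floor_le (mul_nonneg M.cast_nonneg (ha x)))
    exact div_le_of_le_mul₀ M.cast_nonneg (ha x) (by linarith)
  have hlim : ∀ x y, ∃ l ∈ Set.Icc 0 (a x), Filter.Tendsto (fun M => (q M x y / M : ℝ)) U (nhds l) := by
    intro x y
    exact isCompact_Icc.ultrafilter_le_nhds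
      ((Filter.hyperfilter ℕ).map fun M => (q M x y / M : ℝ))
      (Filter.le_principal_iff.2 (Filter.mem_map.2 (Filter.Eventually.of_forall (hbd x y))))
  choose p hp hpl using hlim
  have hbM : ∀ c : ℝ, Filter.Tendsto (fun M : ℕ => c + 1 / (M : ℝ)) U (nhds c) := by
    intro c
    have h := (tendsto_const_nhds (x := c)).add (tendsto_one_div_atTop_nhds_zero_nat (𝕜 := ℝ))
    rw [add_zero] at h
    exact h.mono_left hU
  have hpos : ∀ᶠ M : ℕ in U, 0 < M := hU (Filter.eventually_gt_atTop 0)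
  refine ⟨p, fun x y => (hp x y).1, ?_, ?_, ?_⟩
  · intro x y hy
    refine tendsto_nhds_unique (hpl x y) ?_
    simp [hqN _ x y hy]
  · intro x
    refine tendsto_nhds_unique (tendsto_finsetSum _ fun y _ => hpl x y) ?_
    have hsum : ∀ M : ℕ, ∑ y ∈ N x, (q M x y / M : ℝ) = (⌊M * a x⌋₊ : ℝ) / M := by
      intro M
      rw [← Finset.sum_div, ← hqrow M x]
      push_cast
      rfl
    simp_rw [hsum]
    have := (tendsto_nat_floor_mul_div_atTop (ha x)).comp (tendsto_natCast_atTop_atTop (R := ℝ))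
    refine (this.mono_left hU).congr fun M => ?_
    simp [mul_comm]
  · intro F y
    refine le_of_tendsto_of_tendsto (tendsto_finsetSum _ fun x _ => hpl x y) (hbM (b y)) ?_
    filter_upwards [hpos] with M hM
    have hM' : (0 : ℝ) < M := by exact_mod_cast hM
    rw [← Finset.sum_div, div_le_iff₀ hM', add_mul, one_div, inv_mul_cancel₀ hM'.ne']
    have h1 : (∑ x ∈ F, (q M x y : ℝ)) ≤ ⌈M * b y⌉₊ := by exact_mod_cast hqcol M F y
    have h2 := Nat.ceil_lt_add_one (mul_nonneg M.cast_nonneg (hb y) : 0 ≤ (M : ℝ) * b y)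
    linarith

open scoped ENNReal in
/-- Gluing couplings of consecutive mass distributions `m k`, `m (k + 1)` into a countable weighted
family of discrete paths with marginals `m k` for `k ≤ N`. -/
theorem exists_weighted_paths {ι : Type} [Countable ι] (R : ι → ι → Prop) (hR : ∀ x, R x x)
    (m : ℕ → ι → ℝ≥0∞) (hm : ∀ k x, m k x ≠ ∞) (π : ℕ → ι → ι → ℝ≥0∞)
    (hsupp : ∀ k x y, ¬ R x y → π k x y = 0) (hrow : ∀ k x, ∑' y, π k x y = m k x)
    (hcol : ∀ k y, ∑' x, π k x y = m (k + 1) y) (N : ℕ) :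
    ∃ (κ : Type) (_ : Countable κ) (p : κ → ℕ → ι) (W : κ → ℝ≥0∞),
      (∀ i k, R (p i k) (p i (k + 1))) ∧
      ∀ k ≤ N, ∀ x, ∑' i, {i | p i k = x}.indicator W i = m k x := by
  classical
  induction N with
  | zero =>
    refine ⟨ι, inferInstance, fun x _ => x, m 0, fun i _ => hR i, fun k hk x => ?_⟩
    obtain rfl : k = 0 := by omega
    rw [tsum_eq_single x]
    · simp
    · intro y hy
      simp [hy]
  | succ N ih =>
    obtain ⟨κ, hκ, p, W, hp, hW⟩ := ih
    have hπ0 : ∀ x y, m N x = 0 → π N x y = 0 := by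
      intro x y h0
      have := hrow N x
      rw [h0, ENNReal.tsum_eq_zero] at this
      exact this y
    have hWle : ∀ i, W i ≤ m N (p i N) := by
      intro i
      rw [← hW N le_rfl (p i N)]
      refine le_trans ?_ (ENNReal.le_tsum i)
      simp
    have hWm : ∀ i, W i * (m N (p i N) / m N (p i N)) = W i := by
      intro i
      by_cases h0 : m N (p i N) = 0
      · have : W i = 0 := by simpa [h0] using hWle i
        simp [this]
      · rw [ENNReal.div_self h0 (hm _ _), mul_one]
    refine ⟨κ × ι, inferInstance,
      -- Each path splits according to its next position, with conditional weight `π N x y / m N x`.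
      -- Branches violating `R` have weight zero; they are made to stay put so that the step
      -- relation holds for every path and every `k`.
      fun z k => if k ≤ N then p z.1 k else if R (p z.1 N) z.2 then z.2 else p z.1 N,
      fun z => W z.1 * (π N (p z.1 N) z.2 / m N (p z.1 N)), ?_, ?_⟩
    · rintro ⟨i, y⟩ k
      rcases lt_trichotomy k N with h | rfl | h
      · simp only [h.le, if_true, Nat.succ_le_of_lt h]
        exact hp i k
      · simp only [le_refl, if_true, Nat.not_succ_le_self, if_false]
        split_ifs with h
        · exact h
        · exact hR _
      · have h2 : ¬ k ≤ N := by omega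
        have h3 : ¬ k + 1 ≤ N := by omega
        simp only [h2, h3, if_false]
        exact hR _
    · intro k hk x
      rw [ENNReal.tsum_prod']
      rcases Nat.lt_or_ge N k with h | h
      · obtain rfl : k = N + 1 := by omega
        have h1 : ∀ i, ∑' y, {z : κ × ι | (if N + 1 ≤ N then p z.1 (N + 1) else
            if R (p z.1 N) z.2 then z.2 else p z.1 N) = x}.indicator
            (fun z => W z.1 * (π N (p z.1 N) z.2 / m N (p z.1 N))) (i, y) =
            W i * (π N (p i N) x / m N (p i N)) := by
          intro i
          rw [tsum_eq_single x]
          · by_cases hRx : R (p i N) x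
            · simp [Set.indicator, hRx]
            · simp [Set.indicator, hsupp N _ _ hRx]
          · intro y hy
            by_cases hRy : R (p i N) y
            · simp [Set.indicator, hRy, hy]
            · simp [Set.indicator, hsupp N _ _ hRy]
        simp_rw [h1]
        -- Grouping paths by their position at time `N` lets the inductive marginal replace the sum
        -- of weights.
        have h2 : ∀ i, W i * (π N (p i N) x / m N (p i N)) =
            ∑' z, {i | p i N = z}.indicator W i * (π N z x / m N z) := by
          intro i
          rw [tsum_eq_single (p i N)]
          · simp
          · intro z hz
            simp [hz.symm]
        simp_rw [h2]
        rw [ENNReal.tsum_comm]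
        simp_rw [ENNReal.tsum_mul_right, hW N le_rfl, ← hcol N x]
        refine tsum_congr fun z => ?_
        by_cases h0 : m N z = 0
        · simp [h0, hπ0 z x h0]
        · exact ENNReal.mul_div_cancel h0 (hm _ _)
      · rw [← hW k h x]
        refine tsum_congr fun i => ?_
        by_cases hx : p i k = x
        · simp only [Set.indicator, Set.mem_ofPred_eq, h, if_true, hx]
          simp_rw [div_eq_mul_inv]
          rw [ENNReal.tsum_mul_left, ENNReal.tsum_mul_right, hrow, ← div_eq_mul_inv, hWm]
        · simp [Set.indicator, h, hx]

open scoped ENNReal in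
theorem ENNReal.eq_of_le_of_tsum_eq {ι : Type*} {f g : ι → ℝ≥0∞} (hfg : ∀ i, f i ≤ g i)
    (h : ∑' i, f i = ∑' i, g i) (hfin : ∑' i, f i ≠ ∞) (i : ι) : f i = g i := by
  refine (hfg i).antisymm (not_lt.1 fun hi => ?_)
  exact (ENNReal.tsum_lt_tsum hfin hfg hi).ne h

open scoped ENNReal in
/-- A coupling with exact marginals, from Hall's condition and equality of the total masses. -/
theorem exists_coupling {ι : Type*} [DecidableEq ι] (a b : ι → ℝ)
    (ha : ∀ x, 0 ≤ a x) (hb : ∀ y, 0 ≤ b y) (N : ι → Finset ι)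
    (hall : ∀ A : Finset ι, ∑ x ∈ A, a x ≤ ∑ y ∈ A.biUnion N, b y)
    (hab : ∑' x, ENNReal.ofReal (a x) = ∑' y, ENNReal.ofReal (b y))
    (hfin : ∑' x, ENNReal.ofReal (a x) ≠ ∞) :
    ∃ p : ι → ι → ℝ≥0∞, (∀ x y, y ∉ N x → p x y = 0) ∧
      (∀ x, ∑' y, p x y = ENNReal.ofReal (a x)) ∧ ∀ y, ∑' x, p x y = ENNReal.ofReal (b y) := by
  obtain ⟨p, hp0, hpN, hrow, hcol⟩ := exists_fractional_matching a b ha hb N hall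
  have hrow' : ∀ x, ∑' y, ENNReal.ofReal (p x y) = ENNReal.ofReal (a x) := by
    intro x
    rw [tsum_eq_sum (s := N x) fun y hy => by simp [hpN x y hy],
      ← ENNReal.ofReal_sum_of_nonneg fun y _ => hp0 x y, hrow]
  refine ⟨fun x y => ENNReal.ofReal (p x y), fun x y hy => by simp [hpN x y hy], hrow', ?_⟩
  have hle : ∀ y, ∑' x, ENNReal.ofReal (p x y) ≤ ENNReal.ofReal (b y) := by
    intro y
    rw [ENNReal.tsum_eq_iSup_sum]
    refine iSup_le fun F => ?_
    rw [← ENNReal.ofReal_sum_of_nonneg fun x _ => hp0 x y]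
    exact ENNReal.ofReal_le_ofReal (hcol F y)
  -- Columns are only known to be at most `b`; equality of the finite total masses leaves no slack
  -- in any of them.
  have htot : ∑' y, ∑' x, ENNReal.ofReal (p x y) = ∑' x, ENNReal.ofReal (a x) := by
    rw [ENNReal.tsum_comm]
    simp_rw [hrow']
  exact ENNReal.eq_of_le_of_tsum_eq hle (htot.trans hab) (htot ▸ hfin)

/-! ### Smooth interpolation of discrete paths -/

/-- Outside the open interval the transition takes an extremal value 0 or 1, so its derivative
vanishes there, endpoints included. Unit translates thus never have nonzero derivatives at the same
time. -/
theorem Real.deriv_smoothTransition_eq_zero {t : ℝ} (ht : ¬ (0 < t ∧ t < 1)) :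
    deriv Real.smoothTransition t = 0 := by
  by_cases h : 0 < t
  · refine IsLocalMax.deriv_eq_zero (Filter.Eventually.of_forall fun s => ?_)
    rw [Real.smoothTransition.one_of_one_le (x := t) (by by_contra! h1; exact ht ⟨h, h1⟩)]
    exact Real.smoothTransition.le_one s
  · refine IsLocalMin.deriv_eq_zero (Filter.Eventually.of_forall fun s => ?_)
    rw [Real.smoothTransition.zero_of_nonpos (not_lt.1 h)]
    exact Real.smoothTransition.nonneg s

theorem Real.exists_abs_deriv_smoothTransition_le :
    ∃ c : ℝ, 0 < c ∧ ∀ t, |deriv Real.smoothTransition t| ≤ c := by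
  have hc : Continuous (deriv Real.smoothTransition) :=
    (Real.smoothTransition.contDiff (n := 1)).continuous_deriv le_rfl
  obtain ⟨c, hc⟩ := isCompact_Icc.exists_bound_of_continuousOn (hc.continuousOn (s := Set.Icc 0 1))
  refine ⟨max c 1, by positivity, fun t => ?_⟩
  by_cases ht : 0 < t ∧ t < 1
  · exact (hc t ⟨ht.1.le, ht.2.le⟩).trans (le_max_left _ _)
  · rw [Real.deriv_smoothTransition_eq_zero ht, abs_zero]
    positivity

/-- Points with consecutive distances at most `L` are visited at integer times by a differentiable
path whose speed is controlled by `L`. -/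
theorem exists_differentiable_interpolation {E : Type*} [NormedAddCommGroup E] [NormedSpace ℝ E]
    {c : ℝ} (hc : ∀ t, |deriv Real.smoothTransition t| ≤ c) {L : ℝ} (y : ℕ → E)
    (hy : ∀ k, ‖y (k + 1) - y k‖ ≤ L) (N : ℕ) :
    ∃ γ : ℝ → E, Differentiable ℝ γ ∧ (∀ t, ‖deriv γ t‖ ≤ c * L) ∧
      ∀ k < N, ∀ t ∈ Set.Icc (k : ℝ) (k + 1), ‖γ t - y (k + 1)‖ ≤ L := by
  have hc0 : 0 ≤ c := (abs_nonneg _).trans (hc 0)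
  have hL0 : 0 ≤ L := (norm_nonneg _).trans (hy 0)
  have hder : ∀ t, HasDerivAt
      (fun t : ℝ => y 0 + ∑ j ∈ Finset.range N, Real.smoothTransition (t - j) • (y (j + 1) - y j))
      (∑ j ∈ Finset.range N, deriv Real.smoothTransition (t - j) • (y (j + 1) - y j)) t := by
    intro t
    refine HasDerivAt.const_add _ (HasDerivAt.fun_sum fun j _ => ?_)
    have h1 : HasDerivAt Real.smoothTransition (deriv Real.smoothTransition (t - j)) (t - j) :=
      ((Real.smoothTransition.contDiff (n := 1)).differentiable one_ne_zero _).hasDerivAt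
    exact (h1.comp_sub_const t (j : ℝ)).smul_const _
  refine ⟨_, fun t => (hder t).differentiableAt, fun t => ?_, ?_⟩
  · rw [(hder t).deriv]
    -- At time `t` only the increment with index `⌊t⌋₊` can be moving, so the speed bound does not
    -- accumulate over `N`.
    have h1 : ∀ j ∈ Finset.range N, ‖deriv Real.smoothTransition (t - j) • (y (j + 1) - y j)‖ ≤
        if j = ⌊t⌋₊ then c * L else 0 := by
      intro j _
      rw [norm_smul, Real.norm_eq_abs]
      split_ifs with h
      · exact mul_le_mul (hc _) (hy j) (norm_nonneg _) hc0
      · rw [Real.deriv_smoothTransition_eq_zero, abs_zero, zero_mul]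
        rintro ⟨h1, h2⟩
        have hj : (0 : ℝ) ≤ j := j.cast_nonneg
        exact h ((Nat.floor_eq_iff (by linarith)).2 ⟨by linarith, by linarith⟩).symm
    refine (norm_sum_le_of_le _ h1).trans ?_
    rw [Finset.sum_ite_eq']
    split_ifs
    · exact le_rfl
    · positivity
  · intro k hk t ht
    have h1 : ∑ j ∈ Finset.range N, Real.smoothTransition (t - j) • (y (j + 1) - y j) =
        (∑ j ∈ Finset.range k, (y (j + 1) - y j)) +
          Real.smoothTransition (t - k) • (y (k + 1) - y k) := by
      rw [← Finset.sum_subset (Finset.range_mono (Nat.succ_le_of_lt hk)), Finset.sum_range_succ]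
      · congr 1
        refine Finset.sum_congr rfl fun j hj => ?_
        have : (j : ℝ) + 1 ≤ k := by exact_mod_cast Finset.mem_range.1 hj
        rw [Real.smoothTransition.one_of_one_le (by linarith [ht.1]), one_smul]
      · intro j _ hj
        have : (k : ℝ) + 1 ≤ j := by
          have : k + 1 ≤ j := by simpa using hj
          exact_mod_cast this
        rw [Real.smoothTransition.zero_of_nonpos (by linarith [ht.2]), zero_smul]
    simp only [h1, Finset.sum_range_sub]
    have h2 : y 0 + (y k - y 0 + Real.smoothTransition (t - k) • (y (k + 1) - y k)) - y (k + 1) =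
        (Real.smoothTransition (t - k) - 1) • (y (k + 1) - y k) := by
      rw [sub_smul, one_smul]; abel
    rw [h2, norm_smul, Real.norm_eq_abs]
    have h3 : |Real.smoothTransition (t - k) - 1| ≤ 1 := by
      rw [abs_le]
      constructor <;>
        linarith [Real.smoothTransition.nonneg (t - k), Real.smoothTransition.le_one (t - k)]
    exact (mul_le_mul h3 (hy k) (norm_nonneg _) zero_le_one).trans_eq (one_mul L)

/-! ### Superpositions of plane waves -/

/-- An integrable frequency profile supported in the closed unit ball. -/
structure IsProfile {d : ℕ} (a : EuclideanSpace ℝ (Fin d) → ℂ) : Prop where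
  integrable : Integrable a
  eq_zero : ∀ ξ, 1 < ‖ξ‖ → a ξ = 0

/-- The phase of the plane wave of frequency `ξ` solving the free Schrödinger equation. -/
noncomputable def wavePhase {d : ℕ} (t : ℝ) (x ξ : EuclideanSpace ℝ (Fin d)) : ℝ :=
  2 * Real.pi * inner ℝ x ξ - 4 * Real.pi ^ 2 * ‖ξ‖ ^ 2 * t

/-- The superposition of plane waves with frequency profile `a`. -/
noncomputable def wave {d : ℕ} (a : EuclideanSpace ℝ (Fin d) → ℂ) (t : ℝ)
    (x : EuclideanSpace ℝ (Fin d)) : ℂ :=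
  ∫ ξ, Complex.exp (wavePhase t x ξ * Complex.I) * a ξ

/-- The phase is affine in `s` and the exponential unimodular, so the integrand's derivative is
dominated by `|θ₁ a|`. Both time and directional derivatives of waves are of this form. -/
theorem hasDerivAt_integral_exp_mul {α : Type*} [MeasurableSpace α] {μ : Measure α}
    {θ₀ θ₁ : α → ℝ} {a : α → ℂ} (h0 : AEStronglyMeasurable θ₀ μ) (h1 : AEStronglyMeasurable θ₁ μ)
    (ha : Integrable a μ) (ha1 : Integrable (fun ξ => Complex.I * θ₁ ξ * a ξ) μ) (s : ℝ) :
    HasDerivAt (fun s : ℝ => ∫ ξ, Complex.exp ((θ₀ ξ + s * θ₁ ξ : ℝ) * Complex.I) * a ξ ∂μ)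
      (∫ ξ, Complex.exp ((θ₀ ξ + s * θ₁ ξ : ℝ) * Complex.I) * (Complex.I * θ₁ ξ * a ξ) ∂μ) s := by
  have hm : ∀ s : ℝ, AEStronglyMeasurable
      (fun ξ => Complex.exp ((θ₀ ξ + s * θ₁ ξ : ℝ) * Complex.I)) μ := by
    intro s
    have hc : Continuous fun r : ℝ => Complex.exp (r * Complex.I) := by fun_prop
    exact hc.comp_aestronglyMeasurable (h0.add (h1.const_mul s))
  refine (hasDerivAt_integral_of_dominated_loc_of_deriv_le (bound := fun ξ => ‖Complex.I * θ₁ ξ * a ξ‖)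
    (F' := fun s ξ => Complex.exp ((θ₀ ξ + s * θ₁ ξ : ℝ) * Complex.I) * (Complex.I * θ₁ ξ * a ξ))
    Filter.univ_mem
    (Filter.Eventually.of_forall fun s => (hm s).mul ha.1) ?_ ((hm s).mul ha1.1) ?_ ha1.norm ?_).2
  · refine ha.norm.mono ((hm s).mul ha.1) (Filter.Eventually.of_forall fun ξ => ?_)
    rw [Pi.mul_apply, norm_mul, Complex.norm_exp_ofReal_mul_I, one_mul, norm_norm]
  · refine Filter.Eventually.of_forall fun ξ s _ => ?_
    rw [norm_mul, Complex.norm_exp_ofReal_mul_I, one_mul]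
  · refine Filter.Eventually.of_forall fun ξ s _ => ?_
    have h1 : HasDerivAt (fun s : ℝ => ((θ₀ ξ + s * θ₁ ξ : ℝ) : ℂ) * Complex.I)
        ((θ₁ ξ : ℝ) * Complex.I) s := by
      have h2 : HasDerivAt (fun s : ℝ => θ₀ ξ + s * θ₁ ξ) (θ₁ ξ) s := by
        simpa using ((hasDerivAt_id s).mul_const (θ₁ ξ)).const_add (θ₀ ξ)
      exact h2.ofReal_comp.mul_const _
    have h3 := (h1.cexp).mul_const (a ξ)
    refine h3.congr_deriv ?_
    ring

section Wave

variable {d : ℕ} {a : EuclideanSpace ℝ (Fin d) → ℂ}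

/-- Continuous multipliers are bounded on the unit ball, so derivatives of waves of every order are
again waves. -/
theorem IsProfile.mul (ha : IsProfile a) {f : EuclideanSpace ℝ (Fin d) → ℂ} (hf : Continuous f) :
    IsProfile fun ξ => f ξ * a ξ := by
  obtain ⟨C, hC⟩ := (isCompact_closedBall (0 : EuclideanSpace ℝ (Fin d)) 1).exists_bound_of_continuousOn
    hf.continuousOn
  refine ⟨(ha.integrable.norm.const_mul C).mono' (hf.aestronglyMeasurable.mul ha.integrable.1)
    (Filter.Eventually.of_forall fun ξ => ?_), fun ξ hξ => by simp [ha.eq_zero ξ hξ]⟩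
  rw [norm_mul]
  by_cases h : 1 < ‖ξ‖
  · simp [ha.eq_zero ξ h]
  · exact mul_le_mul_of_nonneg_right (hC ξ (by simpa using h)) (norm_nonneg _)

theorem continuous_wavePhase :
    Continuous fun p : ℝ × EuclideanSpace ℝ (Fin d) × EuclideanSpace ℝ (Fin d) =>
      wavePhase p.1 p.2.1 p.2.2 := by
  unfold wavePhase
  fun_prop

theorem norm_wave_integrand (t : ℝ) (x ξ : EuclideanSpace ℝ (Fin d)) :
    ‖Complex.exp (wavePhase t x ξ * Complex.I) * a ξ‖ = ‖a ξ‖ := by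
  rw [norm_mul, Complex.norm_exp_ofReal_mul_I, one_mul]

theorem aestronglyMeasurable_wave_integrand (ha : IsProfile a) (t : ℝ)
    (x : EuclideanSpace ℝ (Fin d)) :
    AEStronglyMeasurable (fun ξ => Complex.exp (wavePhase t x ξ * Complex.I) * a ξ) volume := by
  refine AEStronglyMeasurable.mul (Continuous.aestronglyMeasurable ?_) ha.integrable.1
  have : Continuous fun ξ => wavePhase t x ξ :=
    continuous_wavePhase.comp (f := fun ξ => (t, x, ξ)) (by fun_prop)
  fun_prop

theorem norm_wave_le (t : ℝ) (x : EuclideanSpace ℝ (Fin d)) :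
    ‖wave a t x‖ ≤ ∫ ξ, ‖a ξ‖ := by
  refine (norm_integral_le_integral_norm _).trans_eq ?_
  simp_rw [norm_wave_integrand]

theorem continuous_wave (ha : IsProfile a) :
    Continuous fun p : ℝ × EuclideanSpace ℝ (Fin d) => wave a p.1 p.2 := by
  unfold wave
  refine continuous_of_dominated (bound := fun ξ => ‖a ξ‖)
    (fun p => aestronglyMeasurable_wave_integrand ha p.1 p.2)
    (fun p => Filter.Eventually.of_forall fun ξ => (norm_wave_integrand _ _ _).le)
    ha.integrable.norm (Filter.Eventually.of_forall fun ξ => ?_)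
  have : Continuous fun p : ℝ × EuclideanSpace ℝ (Fin d) => wavePhase p.1 p.2 ξ :=
    continuous_wavePhase.comp (f := fun p : ℝ × EuclideanSpace ℝ (Fin d) => (p.1, p.2, ξ))
      (by fun_prop)
  fun_prop

theorem continuous_wave_right (ha : IsProfile a) (t : ℝ) : Continuous (wave a t) :=
  (continuous_wave ha).comp (f := fun x => (t, x)) (by fun_prop)

theorem hasDerivAt_wave_time (ha : IsProfile a) (t : ℝ) (x : EuclideanSpace ℝ (Fin d)) :
    HasDerivAt (fun t => wave a t x)
      (wave (fun ξ => Complex.I * ((-(4 * Real.pi ^ 2 * ‖ξ‖ ^ 2) : ℝ) : ℂ) * a ξ) t x) t := by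
  have h := hasDerivAt_integral_exp_mul (μ := volume)
    (θ₀ := fun ξ : EuclideanSpace ℝ (Fin d) => 2 * Real.pi * inner ℝ x ξ)
    (θ₁ := fun ξ => -(4 * Real.pi ^ 2 * ‖ξ‖ ^ 2)) (a := a)
    (Continuous.aestronglyMeasurable (by fun_prop))
    (Continuous.aestronglyMeasurable (by fun_prop)) ha.integrable
    (ha.mul (f := fun ξ => Complex.I * ((-(4 * Real.pi ^ 2 * ‖ξ‖ ^ 2) : ℝ) : ℂ))
      (by fun_prop)).integrable t
  have hp : ∀ (t : ℝ) (ξ : EuclideanSpace ℝ (Fin d)),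
      2 * Real.pi * inner ℝ x ξ + t * -(4 * Real.pi ^ 2 * ‖ξ‖ ^ 2) = wavePhase t x ξ := by
    intro t ξ
    unfold wavePhase
    ring
  simp_rw [hp] at h
  exact h

theorem hasDerivAt_wave_space (ha : IsProfile a) (t : ℝ) (x v : EuclideanSpace ℝ (Fin d)) (s : ℝ) :
    HasDerivAt (fun s : ℝ => wave a t (x + s • v))
      (wave (fun ξ => Complex.I * ((2 * Real.pi * inner ℝ v ξ : ℝ) : ℂ) * a ξ) t (x + s • v)) s := by
  have h := hasDerivAt_integral_exp_mul (μ := volume)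
    (θ₀ := fun ξ : EuclideanSpace ℝ (Fin d) => wavePhase t x ξ)
    (θ₁ := fun ξ => 2 * Real.pi * inner ℝ v ξ) (a := a)
    (continuous_wavePhase.comp (f := fun ξ => (t, x, ξ)) (by fun_prop)).aestronglyMeasurable
    (Continuous.aestronglyMeasurable (by fun_prop)) ha.integrable
    (ha.mul (f := fun ξ => Complex.I * ((2 * Real.pi * inner ℝ v ξ : ℝ) : ℂ))
      (by fun_prop)).integrable s
  have hp : ∀ (s : ℝ) (ξ : EuclideanSpace ℝ (Fin d)),
      wavePhase t x ξ + s * (2 * Real.pi * inner ℝ v ξ) = wavePhase t (x + s • v) ξ := by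
    intro s ξ
    unfold wavePhase
    rw [inner_add_left, inner_smul_left]
    simp only [conj_trivial]
    ring
  simp_rw [hp] at h
  exact h

theorem wavePhase_sub (t : ℝ) (x w ξ : EuclideanSpace ℝ (Fin d)) :
    wavePhase t (x - w) ξ = wavePhase t x ξ - 2 * Real.pi * inner ℝ w ξ := by
  unfold wavePhase
  rw [inner_sub_left]
  ring

/-- A smooth Fourier multiplier acts on waves by convolution. -/
theorem wave_mul_eq_integral (ha : IsProfile a) (χ : 𝓢(EuclideanSpace ℝ (Fin d), ℂ)) (t : ℝ)
    (x : EuclideanSpace ℝ (Fin d)) :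
    wave (fun ξ => χ ξ * a ξ) t x = ∫ w, wave a t (x - w) * (𝓕⁻ χ) w := by
  unfold wave
  simp_rw [← integral_mul_const]
  rw [integral_integral_swap]
  · refine integral_congr_ae (Filter.Eventually.of_forall fun ξ => ?_)
    have h1 : χ ξ = 𝓕 (𝓕⁻ χ) ξ := by rw [FourierTransform.fourier_fourierInv_eq]
    simp only
    rw [h1, SchwartzMap.fourier_coe, Real.fourier_eq', ← integral_mul_const, ← integral_const_mul]
    refine integral_congr_ae (Filter.Eventually.of_forall fun w => ?_)
    simp only [wavePhase_sub, smul_eq_mul]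
    have h2 : (((wavePhase t x ξ - 2 * Real.pi * inner ℝ w ξ : ℝ) : ℂ) * Complex.I) =
        wavePhase t x ξ * Complex.I + ((-2 * Real.pi * inner ℝ w ξ : ℝ) : ℂ) * Complex.I := by
      push_cast; ring
    rw [h2, Complex.exp_add]
    ring
  · have h1 : Integrable (Function.uncurry fun (w ξ : EuclideanSpace ℝ (Fin d)) => (𝓕⁻ χ) w * a ξ)
        (volume.prod volume) := (𝓕⁻ χ).integrable.mul_prod ha.integrable
    have hc : Continuous fun p : EuclideanSpace ℝ (Fin d) × EuclideanSpace ℝ (Fin d) =>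
        Complex.exp (wavePhase t (x - p.1) p.2 * Complex.I) := by
      have : Continuous fun p : EuclideanSpace ℝ (Fin d) × EuclideanSpace ℝ (Fin d) =>
          wavePhase t (x - p.1) p.2 := continuous_wavePhase.comp
        (f := fun p : EuclideanSpace ℝ (Fin d) × EuclideanSpace ℝ (Fin d) => (t, x - p.1, p.2))
        (by fun_prop)
      fun_prop
    have h2 := h1.bdd_mul (c := 1) hc.aestronglyMeasurable
      (Filter.Eventually.of_forall fun p => (Complex.norm_exp_ofReal_mul_I _).le)
    refine h2.congr (Filter.Eventually.of_forall fun p => ?_)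
    simp only [Function.uncurry]
    ring

end Wave

/-! ### From the weak equation to a plane wave representation -/

/-- Product rule when the second factor is only continuous, and weakly differentiable against the
value of the first factor. -/
theorem hasDerivAt_inner_of_weak {H : Type*} [NormedAddCommGroup H] [InnerProductSpace ℂ H]
    {C U : ℝ → H} {C' : H} {D : ℂ} {t : ℝ} (hC : HasDerivAt C C' t) (hU : ContinuousAt U t)
    (hD : HasDerivAt (fun s => inner ℂ (C t) (U s)) D t) :
    HasDerivAt (fun s => inner ℂ (C s) (U s)) (inner ℂ C' (U t) + D) t := by
  rw [hasDerivAt_iff_tendsto_slope] at *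
  -- The increment splits as `⟨C s - C t, U s⟩ + ⟨C t, U s - U t⟩`: norm convergence handles the
  -- first term, weak differentiability the second.
  have h1 : Filter.Tendsto (fun s => inner ℂ (slope C t s) (U s)) (nhdsWithin t {t}ᶜ)
      (nhds (inner ℂ C' (U t))) := hC.inner (hU.tendsto.mono_left nhdsWithin_le_nhds)
  refine (h1.add hD).congr fun s => ?_
  simp only [slope_def_module, ← Complex.coe_smul, inner_smul_left, Complex.conj_ofReal,
    inner_sub_left, smul_eq_mul]
  ring

section FourierLp

variable {d : ℕ}

theorem integral_fourier_mul_Lp (f : Lp (α := EuclideanSpace ℝ (Fin d)) ℂ 2)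
    (ψ : 𝓢(EuclideanSpace ℝ (Fin d), ℂ)) :
    ∫ x, (𝓕 ψ) x * f x = ∫ ξ, ψ ξ * (𝓕 f : Lp (α := EuclideanSpace ℝ (Fin d)) ℂ 2) ξ := by
  have h := congrArg (fun T : 𝓢'(EuclideanSpace ℝ (Fin d), ℂ) => T ψ)
    (Lp.fourier_toTemperedDistribution_eq f)
  simp only [TemperedDistribution.fourier_apply, Lp.toTemperedDistribution_apply, smul_eq_mul] at h
  exact h

/-- Transfers the equation to frequency space: testing against `Δ (𝓕 χ)` amounts to multiplying the
test function `χ` by `-4π²|ξ|²`. -/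
theorem laplacian_fourier_eq (χ η : 𝓢(EuclideanSpace ℝ (Fin d), ℂ))
    (hη : ∀ ξ, η ξ = ((4 * Real.pi ^ 2 * ‖ξ‖ ^ 2 : ℝ) : ℂ) * χ ξ) :
    Δ (𝓕 χ) = -𝓕 η := by
  have hi : ∀ m : EuclideanSpace ℝ (Fin d), (inner ℝ · m).HasTemperateGrowth := by
    intro m; fun_prop
  let b := stdOrthonormalBasis ℝ (EuclideanSpace ℝ (Fin d))
  rw [SchwartzMap.laplacian_eq_sum b]
  simp_rw [SchwartzMap.lineDerivOp_fourier_eq]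
  rw [← FourierTransform.fourier_sum, ← FourierTransform.fourier_neg]
  congr 1
  ext ξ
  simp only [sum_apply, smul_apply, neg_apply, hη,
    SchwartzMap.smulLeftCLM_apply_apply (hi _), ← b.sum_sq_inner_left ξ]
  push_cast
  rw [Finset.mul_sum, Finset.sum_mul, ← Finset.sum_neg_distrib]
  refine Finset.sum_congr rfl fun i _ => ?_
  simp only [smul_eq_mul, Complex.real_smul]
  linear_combination (4 * Real.pi ^ 2 * (inner ℝ ξ (b i) : ℂ) ^ 2 * χ ξ) * Complex.I_sq

/-- The test function `g` modulated by the Schrödinger phase. -/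
noncomputable def modulatedTest (g : EuclideanSpace ℝ (Fin d) → ℝ) (hg : ContDiff ℝ (⊤ : ℕ∞) g)
    (hgc : HasCompactSupport g) (s : ℝ) : 𝓢(EuclideanSpace ℝ (Fin d), ℂ) :=
  HasCompactSupport.toSchwartzMap
    (f := fun ξ => Complex.exp ((s * (4 * Real.pi ^ 2 * ‖ξ‖ ^ 2) : ℝ) * Complex.I) * (g ξ : ℂ))
    ((hgc.comp_left (g := fun r : ℝ => (r : ℂ)) (by simp)).mul_left)
    (by
      have h1 : ContDiff ℝ (⊤ : ℕ∞) fun ξ : EuclideanSpace ℝ (Fin d) => ‖ξ‖ ^ 2 := contDiff_norm_sq ℝ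
      have h2 : ContDiff ℝ (⊤ : ℕ∞) fun ξ : EuclideanSpace ℝ (Fin d) =>
          ((s * (4 * Real.pi ^ 2 * ‖ξ‖ ^ 2) : ℝ) : ℂ) :=
        Complex.ofRealCLM.contDiff.comp (contDiff_const.mul (contDiff_const.mul h1))
      exact ((h2.mul contDiff_const).cexp).mul (Complex.ofRealCLM.contDiff.comp hg))

variable {g : EuclideanSpace ℝ (Fin d) → ℝ} (hg : ContDiff ℝ (⊤ : ℕ∞) g)
  (hgc : HasCompactSupport g)

theorem modulatedTest_apply (s : ℝ) (ξ : EuclideanSpace ℝ (Fin d)) :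
    modulatedTest g hg hgc s ξ =
      Complex.exp ((s * (4 * Real.pi ^ 2 * ‖ξ‖ ^ 2) : ℝ) * Complex.I) * (g ξ : ℂ) := rfl

theorem hasTemperateGrowth_const_mul_norm_sq (c : ℂ) :
    (fun ξ : EuclideanSpace ℝ (Fin d) =>
      c * ((4 * Real.pi ^ 2 * ‖ξ‖ ^ 2 : ℝ) : ℂ)).HasTemperateGrowth := by
  fun_prop

/-- Differentiability holds in `L²` norm, as the strong factor of `hasDerivAt_inner_of_weak`
requires. The reason is that the phase speed is bounded on the compact support of `g`, so the Taylor
remainder is uniformly quadratic in `h`. -/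
theorem hasDerivAt_toLp_modulatedTest (s : ℝ) :
    HasDerivAt (fun s => (modulatedTest g hg hgc s).toLp 2 volume)
      ((SchwartzMap.smulLeftCLM ℂ (fun ξ : EuclideanSpace ℝ (Fin d) =>
        Complex.I * ((4 * Real.pi ^ 2 * ‖ξ‖ ^ 2 : ℝ) : ℂ)) (modulatedTest g hg hgc s)).toLp 2 volume)
      s := by
  set q : EuclideanSpace ℝ (Fin d) → ℝ := fun ξ => 4 * Real.pi ^ 2 * ‖ξ‖ ^ 2 with hq
  have hqI : (fun ξ => Complex.I * (q ξ : ℂ)).HasTemperateGrowth :=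
    hasTemperateGrowth_const_mul_norm_sq _
  set m := modulatedTest g hg hgc
  set m' := SchwartzMap.smulLeftCLM ℂ (fun ξ => Complex.I * (q ξ : ℂ)) (m s) with hm'
  set m'' := SchwartzMap.smulLeftCLM ℂ (fun ξ => Complex.I * (q ξ : ℂ)) m' with hm''
  obtain ⟨Q, hQ⟩ : ∃ Q, ∀ ξ ∈ tsupport g, ‖q ξ‖ ≤ Q :=
    hgc.isCompact.exists_bound_of_continuousOn (by fun_prop)
  -- From `|e^z - 1 - z| ≤ |z|²` for `|z| ≤ 1` with `z = i h q(ξ)`; `m''` carries the factor `(i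
  -- q)²`.
  have hbound : ∀ h : ℝ, |h| * Q ≤ 1 →
      ‖(m (s + h)).toLp 2 volume - (m s).toLp 2 volume - h • m'.toLp 2 volume‖ ≤
        ‖((h : ℂ) ^ 2) • m''.toLp 2 volume‖ := by
    intro h hh
    refine Lp.norm_le_norm_of_ae_le ?_
    filter_upwards [Lp.coeFn_sub ((m (s + h)).toLp 2 volume - (m s).toLp 2 volume)
        (h • m'.toLp 2 volume), Lp.coeFn_sub ((m (s + h)).toLp 2 volume) ((m s).toLp 2 volume),
      Lp.coeFn_smul h (m'.toLp 2 volume), Lp.coeFn_smul ((h : ℂ) ^ 2) (m''.toLp 2 volume),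
      (m (s + h)).coeFn_toLp 2 volume, (m s).coeFn_toLp 2 volume, m'.coeFn_toLp 2 volume,
      m''.coeFn_toLp 2 volume] with ξ h1 h2 h3 h4 h5 h6 h7 h8
    rw [h1, h4, Pi.sub_apply, h2, h3, Pi.sub_apply, Pi.smul_apply, Pi.smul_apply, h5, h6, h7, h8]
    simp only [hm'', hm', SchwartzMap.smulLeftCLM_apply_apply hqI]
    by_cases hξ : ξ ∈ tsupport g
    · have h9 : m (s + h) ξ = Complex.exp ((h * q ξ : ℝ) * Complex.I) * m s ξ := by
        simp only [m, modulatedTest_apply]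
        rw [← mul_assoc (Complex.exp _) (Complex.exp _), ← Complex.exp_add]
        congr 2
        simp only [hq]
        push_cast
        ring
      have h10 : ‖((h * q ξ : ℝ) : ℂ) * Complex.I‖ ≤ 1 := by
        rw [norm_mul, Complex.norm_I, mul_one, Complex.norm_real, norm_mul]
        exact (mul_le_mul_of_nonneg_left (hQ ξ hξ) (abs_nonneg h)).trans hh
      have h11 := Complex.norm_exp_sub_one_sub_id_le h10
      have h12 : m (s + h) ξ - m s ξ - h • (Complex.I * (q ξ : ℂ)) • m s ξ =
          (Complex.exp ((h * q ξ : ℝ) * Complex.I) - 1 - ((h * q ξ : ℝ) : ℂ) * Complex.I) * m s ξ := by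
        rw [h9]
        simp only [smul_eq_mul, Complex.real_smul]
        push_cast
        ring
      rw [h12, norm_mul]
      refine (mul_le_mul_of_nonneg_right h11 (norm_nonneg _)).trans_eq ?_
      rw [← norm_pow, ← norm_mul]
      congr 1
      simp only [smul_eq_mul]
      push_cast
      ring
    · have h9 : ∀ s, m s ξ = 0 := by
        intro s
        simp [m, modulatedTest_apply, image_eq_zero_of_notMem_tsupport hξ]
      simp [h9]
  rw [hasDerivAt_iff_isLittleO_nhds_zero]
  have hO : (fun h : ℝ => (m (s + h)).toLp 2 volume - (m s).toLp 2 volume - h • m'.toLp 2 volume)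
      =O[nhds 0] fun h : ℝ => h ^ 2 := by
    refine Asymptotics.IsBigO.of_bound ‖m''.toLp 2 volume‖ ?_
    have hev : ∀ᶠ h : ℝ in nhds 0, |h| * Q < 1 := by
      have hc : ContinuousAt (fun h : ℝ => |h| * Q) 0 := by fun_prop
      exact hc.eventually (gt_mem_nhds (by simp))
    filter_upwards [hev] with h hh
    refine (hbound h hh.le).trans_eq ?_
    rw [norm_smul, mul_comm]
    simp
  exact hO.trans_isLittleO (by simpa using Asymptotics.isLittleO_pow_id (𝕜 := ℝ) one_lt_two)

end FourierLp

section Representation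

variable {d : ℕ} {u : ℝ → EuclideanSpace ℝ (Fin d) → ℂ}

/-- The `L²` Fourier transform of a solution at time `t`. -/
noncomputable def IsSchrodingerSolution.fourierLp (hu : IsSchrodingerSolution u) (t : ℝ) :
    Lp (α := EuclideanSpace ℝ (Fin d)) ℂ 2 volume :=
  𝓕 ((hu.memLp t).toLp (u t))

theorem IsSchrodingerSolution.hasDerivAt_integral_fourier (hu : IsSchrodingerSolution u)
    (ψ η : 𝓢(EuclideanSpace ℝ (Fin d), ℂ))
    (hη : ∀ ξ, η ξ = ((4 * Real.pi ^ 2 * ‖ξ‖ ^ 2 : ℝ) : ℂ) * ψ ξ) (t : ℝ) :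
    HasDerivAt (fun s => ∫ ξ, ψ ξ * hu.fourierLp s ξ)
      (-Complex.I * ∫ ξ, η ξ * hu.fourierLp t ξ) t := by
  have h1 : ∀ (φ : 𝓢(EuclideanSpace ℝ (Fin d), ℂ)) (s : ℝ), ∫ x, u s x * (𝓕 φ) x =
      ∫ ξ, φ ξ * hu.fourierLp s ξ := by
    intro φ s
    rw [IsSchrodingerSolution.fourierLp, ← integral_fourier_mul_Lp]
    refine integral_congr_ae ?_
    filter_upwards [(hu.memLp s).coeFn_toLp] with x hx
    rw [hx, mul_comm]
  have h2 := hu.equation (𝓕 ψ) t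
  simp_rw [h1 ψ] at h2
  refine h2.congr_deriv ?_
  rw [laplacian_fourier_eq ψ η hη, ← h1 η t]
  simp only [neg_apply, mul_neg, integral_neg, neg_mul]

/-- The phase put on the test function rotates against that of the solution, so the pairing has zero
time derivative by the weak product rule. -/
theorem IsSchrodingerSolution.integral_modulatedTest_mul_fourier (hu : IsSchrodingerSolution u)
    {g : EuclideanSpace ℝ (Fin d) → ℝ} (hg : ContDiff ℝ (⊤ : ℕ∞) g) (hgc : HasCompactSupport g)
    (t : ℝ) :
    ∫ ξ, modulatedTest g hg hgc t ξ * hu.fourierLp t ξ =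
      ∫ ξ, modulatedTest g hg hgc 0 ξ * hu.fourierLp 0 ξ := by
  set U := hu.fourierLp with hU
  have hUc : Continuous U :=
    (Lp.fourierTransformₗᵢ (EuclideanSpace ℝ (Fin d)) ℂ).continuous.comp hu.continuous_toLp
  set m := modulatedTest g hg hgc
  have hqI : (fun ξ : EuclideanSpace ℝ (Fin d) =>
      Complex.I * ((4 * Real.pi ^ 2 * ‖ξ‖ ^ 2 : ℝ) : ℂ)).HasTemperateGrowth :=
    hasTemperateGrowth_const_mul_norm_sq _
  have hq1 : (fun ξ : EuclideanSpace ℝ (Fin d) =>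
      (1 : ℂ) * ((4 * Real.pi ^ 2 * ‖ξ‖ ^ 2 : ℝ) : ℂ)).HasTemperateGrowth :=
    hasTemperateGrowth_const_mul_norm_sq _
  have hinner : ∀ (φ : 𝓢(EuclideanSpace ℝ (Fin d), ℂ))
      (V : Lp (α := EuclideanSpace ℝ (Fin d)) ℂ 2 volume),
      inner ℂ (φ.toLp 2 volume) V = ∫ ξ, (starRingEnd ℂ) (φ ξ) * V ξ := by
    intro φ V
    rw [L2.inner_def]
    refine integral_congr_ae ?_
    filter_upwards [φ.coeFn_toLp 2 volume] with ξ hξ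
    rw [hξ, RCLike.inner_apply, mul_comm]
  have hconj : ∀ s ξ, (starRingEnd ℂ) (m (-s) ξ) = m s ξ := by
    intro s ξ
    simp only [m, modulatedTest_apply, map_mul, Complex.conj_ofReal, ← Complex.exp_conj,
      Complex.conj_I]
    push_cast
    ring_nf
  -- The inner product conjugates its first slot, so the test function is inserted at time `-t` to
  -- come out at time `t`.
  have hG : ∀ t, inner ℂ ((m (-t)).toLp 2 volume) (U t) = ∫ ξ, m t ξ * U t ξ := by
    intro t
    rw [hinner]
    simp_rw [hconj]
  have hder : ∀ t, HasDerivAt (fun s => inner ℂ ((m (-s)).toLp 2 volume) (U s)) 0 t := by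
    intro t
    have hC : HasDerivAt (fun s => (m (-s)).toLp 2 volume) _ t :=
      HasDerivAt.scomp t (hasDerivAt_toLp_modulatedTest hg hgc (-t)) (hasDerivAt_neg t)
    have hD := hu.hasDerivAt_integral_fourier (m t) (SchwartzMap.smulLeftCLM ℂ _ (m t))
      (fun ξ => by rw [SchwartzMap.smulLeftCLM_apply_apply hq1, one_mul, smul_eq_mul]) t
    have hfun : (fun s => inner ℂ ((m (-t)).toLp 2 volume) (U s)) =
        fun s => ∫ ξ, m t ξ * hu.fourierLp s ξ := by
      simp_rw [hinner, hconj, hU]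
    rw [← hfun] at hD
    refine (hasDerivAt_inner_of_weak hC hUc.continuousAt hD).congr_deriv ?_
    rw [neg_one_smul, inner_neg_left, hinner, ← integral_const_mul, neg_add_eq_zero]
    refine integral_congr_ae (Filter.Eventually.of_forall fun ξ => ?_)
    simp only [SchwartzMap.smulLeftCLM_apply_apply hqI, SchwartzMap.smulLeftCLM_apply_apply hq1,
      smul_eq_mul, map_mul, Complex.conj_I, Complex.conj_ofReal]
    have h := hconj t ξ
    simp only [m] at h ⊢
    rw [h]
    ring
  have hconst := is_const_of_deriv_eq_zero (fun t => (hder t).differentiableAt)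
    (fun t => (hder t).deriv) t 0
  rw [hG, hG] at hconst
  exact hconst

/-- Conservation of the modulated pairings for all test functions `g` identifies `e^{4π²i|ξ|²t} û_t`
with `û_0` almost everywhere. -/
theorem IsSchrodingerSolution.fourier_ae_eq (hu : IsSchrodingerSolution u) (t : ℝ) :
    hu.fourierLp t =ᵐ[volume] fun ξ =>
      Complex.exp ((-(4 * Real.pi ^ 2 * ‖ξ‖ ^ 2 * t) : ℝ) * Complex.I) * hu.fourierLp 0 ξ := by
  set U := hu.fourierLp with hU
  have hloc : ∀ t, LocallyIntegrable (U t) volume := fun t =>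
    (Lp.memLp (U t)).locallyIntegrable one_le_two
  have hphase : Continuous fun ξ : EuclideanSpace ℝ (Fin d) =>
      Complex.exp ((t * (4 * Real.pi ^ 2 * ‖ξ‖ ^ 2) : ℝ) * Complex.I) := by fun_prop
  have h := ae_eq_of_integral_contDiff_smul_eq (μ := volume)
    (f := fun ξ => Complex.exp ((t * (4 * Real.pi ^ 2 * ‖ξ‖ ^ 2) : ℝ) * Complex.I) * U t ξ)
    (f' := U 0) ?_ (hloc 0) ?_
  · filter_upwards [h] with ξ hξ
    rw [← hξ, ← mul_assoc, ← Complex.exp_add]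
    have : ((-(4 * Real.pi ^ 2 * ‖ξ‖ ^ 2 * t) : ℝ) : ℂ) * Complex.I +
        ((t * (4 * Real.pi ^ 2 * ‖ξ‖ ^ 2) : ℝ) : ℂ) * Complex.I = 0 := by
      push_cast; ring
    rw [this, Complex.exp_zero, one_mul]
  · refine MemLp.locallyIntegrable (p := 2) ?_ one_le_two
    refine (Lp.memLp (U t)).of_le (hphase.aestronglyMeasurable.mul (Lp.aestronglyMeasurable _))
      (Filter.Eventually.of_forall fun ξ => ?_)
    rw [norm_mul, Complex.norm_exp_ofReal_mul_I, one_mul]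
  · intro g hg hgc
    have h1 := hu.integral_modulatedTest_mul_fourier hg hgc t
    simp only [modulatedTest_apply] at h1
    refine Eq.trans ?_ (h1.trans ?_)
    · refine integral_congr_ae (Filter.Eventually.of_forall fun ξ => ?_)
      simp only [Complex.real_smul, hU]
      ring
    · refine integral_congr_ae (Filter.Eventually.of_forall fun ξ => ?_)
      simp [hU]

/-- Plancherel, since the Fourier transforms at different times differ by a unimodular factor. -/
theorem IsSchrodingerSolution.integral_norm_sq_eq (hu : IsSchrodingerSolution u) (t : ℝ) :
    ∫ x, ‖u t x‖ ^ 2 = ∫ x, ‖u 0 x‖ ^ 2 := by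
  have h1 : ∀ s, ∫ x, ‖u s x‖ ^ 2 = ‖(hu.memLp s).toLp (u s)‖ ^ 2 := by
    intro s
    have h := L2.inner_def (𝕜 := ℂ) ((hu.memLp s).toLp (u s)) ((hu.memLp s).toLp (u s))
    rw [inner_self_eq_norm_sq_to_K] at h
    have h2 : ∫ x, ((‖u s x‖ ^ 2 : ℝ) : ℂ) = ((‖(hu.memLp s).toLp (u s)‖ : ℝ) : ℂ) ^ 2 := by
      refine Eq.trans ?_ h.symm
      refine integral_congr_ae ?_
      filter_upwards [(hu.memLp s).coeFn_toLp] with x hx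
      rw [hx, inner_self_eq_norm_sq_to_K]
      simp
    rw [integral_complex_ofReal] at h2
    exact_mod_cast h2
  rw [h1, h1, ← Lp.norm_fourier_eq, ← Lp.norm_fourier_eq ((hu.memLp 0).toLp (u 0))]
  congr 1
  change ‖hu.fourierLp t‖ = ‖hu.fourierLp 0‖
  refine le_antisymm (Lp.norm_le_norm_of_ae_le ?_) (Lp.norm_le_norm_of_ae_le ?_)
  all_goals
    filter_upwards [hu.fourier_ae_eq t] with ξ hξ
    rw [hξ, norm_mul, Complex.norm_exp_ofReal_mul_I, one_mul]

/-- A band-limited solution is a superposition of plane waves. -/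
theorem IsSchrodingerSolution.exists_eq_wave (hu : IsSchrodingerSolution u)
    (hc : ∀ t, Continuous (u t))
    (hsupp : HasFourierSupportIn (u 0) (hu.memLp 0) (Metric.closedBall 0 1)) :
    ∃ a, IsProfile a ∧ ∀ t x, u t x = wave a t x := by
  set U := hu.fourierLp with hU
  -- Cutting off turns almost everywhere vanishing into pointwise vanishing, and an `L²` function on
  -- a ball is integrable.
  set a := (Metric.closedBall (0 : EuclideanSpace ℝ (Fin d)) 1).indicator (U 0) with ha
  have ha0 : ∀ ξ, 1 < ‖ξ‖ → a ξ = 0 := by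
    intro ξ hξ
    refine Set.indicator_of_notMem ?_ _
    simpa using hξ
  have haP : IsProfile a := by
    refine ⟨?_, ha0⟩
    rw [ha, integrable_indicator_iff Metric.isClosed_closedBall.measurableSet]
    exact ((Lp.memLp (U 0)).locallyIntegrable one_le_two).integrableOn_isCompact
      (isCompact_closedBall 0 1)
  have haU : a =ᵐ[volume] U 0 := by
    filter_upwards [hsupp] with ξ hξ
    by_cases h1 : ξ ∈ Metric.closedBall (0 : EuclideanSpace ℝ (Fin d)) 1
    · exact Set.indicator_of_mem h1 _
    · rw [ha, Set.indicator_of_notMem h1]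
      refine (hξ ?_).symm
      simp only [Metric.mem_closedBall, dist_zero_right, not_le] at h1 ⊢
      -- In Mathlib's normalization the support has radius `1/(2π)`; the unit ball contains it and
      -- suffices.
      rw [norm_smul, Real.norm_eq_abs, abs_of_pos Real.two_pi_pos]
      nlinarith [Real.pi_gt_three]
  refine ⟨a, haP, fun t => congrFun ?_⟩
  refine ((hc t).ae_eq_iff_eq volume (continuous_wave_right haP t)).1 ?_
  refine ae_eq_of_integral_contDiff_smul_eq ((hc t).locallyIntegrable)
    (continuous_wave_right haP t).locallyIntegrable fun g hg hgc => ?_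
  set ψ : 𝓢(EuclideanSpace ℝ (Fin d), ℂ) := HasCompactSupport.toSchwartzMap
    (f := fun ξ => (g ξ : ℂ)) (hgc.comp_left (g := fun r : ℝ => (r : ℂ)) (by simp))
    (Complex.ofRealCLM.contDiff.comp hg) with hψ
  have hψa : ∀ x, ψ x = (g x : ℂ) := fun x => rfl
  have h1 : ∫ x, g x • u t x = ∫ ξ, (𝓕⁻ ψ) ξ * U t ξ := by
    rw [hU, IsSchrodingerSolution.fourierLp, ← integral_fourier_mul_Lp, FourierTransform.fourier_fourierInv_eq]
    refine integral_congr_ae ?_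
    filter_upwards [(hu.memLp t).coeFn_toLp] with x hx
    rw [hx, hψa, Complex.real_smul]
  rw [h1]
  have h2 : ∫ ξ, (𝓕⁻ ψ) ξ * U t ξ =
      ∫ ξ, ∫ x, ψ x * (Complex.exp (wavePhase t x ξ * Complex.I) * a ξ) := by
    refine integral_congr_ae ?_
    filter_upwards [hu.fourier_ae_eq t, haU] with ξ h3 h4
    rw [h3, SchwartzMap.fourierInv_coe, Real.fourierInv_eq', ← integral_mul_const]
    refine integral_congr_ae (Filter.Eventually.of_forall fun x => ?_)
    change _ * (_ * U 0 ξ) = _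
    simp only [← h4, smul_eq_mul]
    have h5 : (wavePhase t x ξ : ℂ) * Complex.I =
        ((2 * Real.pi * inner ℝ x ξ : ℝ) : ℂ) * Complex.I +
        ((-(4 * Real.pi ^ 2 * ‖ξ‖ ^ 2 * t) : ℝ) : ℂ) * Complex.I := by
      unfold wavePhase
      push_cast; ring
    rw [h5, Complex.exp_add]
    ring
  rw [h2, integral_integral_swap]
  · refine integral_congr_ae (Filter.Eventually.of_forall fun x => ?_)
    simp only
    rw [integral_const_mul, hψa, Complex.real_smul]
    rfl
  · have h3 : Integrable (Function.uncurry fun (ξ x : EuclideanSpace ℝ (Fin d)) => a ξ * ψ x)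
        (volume.prod volume) := haP.integrable.mul_prod ψ.integrable
    have hcont : Continuous fun p : EuclideanSpace ℝ (Fin d) × EuclideanSpace ℝ (Fin d) =>
        Complex.exp (wavePhase t p.2 p.1 * Complex.I) := by
      have : Continuous fun p : EuclideanSpace ℝ (Fin d) × EuclideanSpace ℝ (Fin d) =>
          wavePhase t p.2 p.1 := continuous_wavePhase.comp
        (f := fun p : EuclideanSpace ℝ (Fin d) × EuclideanSpace ℝ (Fin d) => (t, p.2, p.1))
        (by fun_prop)
      fun_prop
    have h4 := h3.bdd_mul (c := 1) hcont.aestronglyMeasurable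
      (Filter.Eventually.of_forall fun p => (Complex.norm_exp_ofReal_mul_I _).le)
    refine h4.congr (Filter.Eventually.of_forall fun p => ?_)
    simp only [Function.uncurry]
    ring

end Representation

/-! ### Averaging against a slowly varying weight -/

section Kernel

variable {d : ℕ}

/-- A slowly varying integrable weight. -/
noncomputable def slowKernel (z : EuclideanSpace ℝ (Fin d)) : ℝ := ((1 + ‖z‖) ^ (d + 1))⁻¹

theorem slowKernel_pos (z : EuclideanSpace ℝ (Fin d)) : 0 < slowKernel z := by
  unfold slowKernel; positivity

theorem slowKernel_neg (z : EuclideanSpace ℝ (Fin d)) : slowKernel (-z) = slowKernel z := by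
  unfold slowKernel; rw [norm_neg]

theorem continuous_slowKernel : Continuous (slowKernel (d := d)) := by
  unfold slowKernel
  refine Continuous.inv₀ (by fun_prop) fun z => ?_
  positivity

theorem integrable_slowKernel : Integrable (slowKernel (d := d)) := by
  have h := integrable_one_add_norm (μ := (volume : Measure (EuclideanSpace ℝ (Fin d))))
    (r := (d : ℝ) + 1) (by simp)
  refine h.congr (Filter.Eventually.of_forall fun z => ?_)
  simp only [slowKernel]
  rw [Real.rpow_neg (by positivity), ← Nat.cast_succ, Real.rpow_natCast]

/-- Because `1 + |z| ≤ (1 + |z + w|)(1 + |w|)`: polynomial decay changes under translation only by a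
polynomial factor. -/
theorem slowKernel_le_mul (z w : EuclideanSpace ℝ (Fin d)) :
    slowKernel (z + w) ≤ (1 + ‖w‖) ^ (d + 1) * slowKernel z := by
  unfold slowKernel
  rw [← div_eq_mul_inv, inv_eq_one_div, div_le_div_iff₀ (by positivity) (by positivity), one_mul,
    ← mul_pow]
  refine pow_le_pow_left₀ (by positivity) ?_ _
  have : ‖z‖ ≤ ‖z + w‖ + ‖w‖ := by
    simpa using norm_sub_le (z + w) w
  nlinarith [norm_nonneg w, norm_nonneg (z + w), mul_nonneg (norm_nonneg w) (norm_nonneg (z + w))]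

/-- The average of `f` against the slowly varying weight. -/
noncomputable def slowAverage (f : EuclideanSpace ℝ (Fin d) → ℝ)
    (y : EuclideanSpace ℝ (Fin d)) : ℝ :=
  ∫ z, f (y + z) * slowKernel z

variable {f : EuclideanSpace ℝ (Fin d) → ℝ} {B : ℝ}

theorem integrable_mul_of_bounded {h k : EuclideanSpace ℝ (Fin d) → ℝ} (hk : Integrable k)
    (hc : Continuous h) (hB : ∀ x, |h x| ≤ B) : Integrable fun z => h z * k z :=
  hk.bdd_mul hc.aestronglyMeasurable (Filter.Eventually.of_forall hB)

theorem integrable_slowAverage_integrand (hc : Continuous f) (hB : ∀ x, |f x| ≤ B)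
    (y : EuclideanSpace ℝ (Fin d)) : Integrable fun z => f (y + z) * slowKernel z :=
  integrable_mul_of_bounded integrable_slowKernel (by fun_prop) fun _ => hB _

theorem slowAverage_nonneg (h0 : ∀ x, 0 ≤ f x) (y : EuclideanSpace ℝ (Fin d)) :
    0 ≤ slowAverage f y :=
  integral_nonneg fun z => mul_nonneg (h0 _) (slowKernel_pos z).le

theorem abs_slowAverage_le (hB : ∀ x, |f x| ≤ B)
    (y : EuclideanSpace ℝ (Fin d)) : |slowAverage f y| ≤ B * ∫ z, slowKernel (d := d) z := by
  unfold slowAverage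
  rw [← integral_const_mul, ← Real.norm_eq_abs]
  refine norm_integral_le_of_norm_le (integrable_slowKernel.const_mul B)
    (Filter.Eventually.of_forall fun z => ?_)
  rw [norm_mul, Real.norm_of_nonneg (slowKernel_pos z).le]
  exact mul_le_mul_of_nonneg_right (hB _) (slowKernel_pos z).le

theorem slowAverage_sub_le (hc : Continuous f) (hB : ∀ x, |f x| ≤ B) (h0 : ∀ x, 0 ≤ f x)
    (y w : EuclideanSpace ℝ (Fin d)) :
    slowAverage f (y - w) ≤ (1 + ‖w‖) ^ (d + 1) * slowAverage f y := by
  unfold slowAverage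
  rw [← integral_add_right_eq_self _ w, ← integral_const_mul]
  refine integral_mono ?_ ((integrable_slowAverage_integrand hc hB y).const_mul _) fun z => ?_
  · exact (integrable_slowAverage_integrand hc hB (y - w)).comp_add_right w
  · simp only [show y - w + (z + w) = y + z by abel]
    have := mul_le_mul_of_nonneg_left (slowKernel_le_mul z w) (h0 (y + z))
    linarith

theorem slowAverage_le_of_dist_le (hc : Continuous f) (hB : ∀ x, |f x| ≤ B) (h0 : ∀ x, 0 ≤ f x)
    {x y : EuclideanSpace ℝ (Fin d)} (hxy : dist x y ≤ 1) :
    slowAverage f x ≤ 2 ^ (d + 1) * slowAverage f y := by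
  have h := slowAverage_sub_le hc hB h0 y (y - x)
  rw [sub_sub_cancel] at h
  refine h.trans (mul_le_mul_of_nonneg_right ?_ (slowAverage_nonneg h0 y))
  refine pow_le_pow_left₀ (by positivity) ?_ _
  rw [dist_comm, dist_eq_norm] at hxy
  linarith

theorem continuous_slowAverage (hc : Continuous f) (hB : ∀ x, |f x| ≤ B) :
    Continuous (slowAverage f) := by
  unfold slowAverage
  refine continuous_of_dominated (bound := fun z => B * slowKernel z) (fun y => ?_) (fun y => ?_)
    (integrable_slowKernel.const_mul B) (Filter.Eventually.of_forall fun z => by fun_prop)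
  · exact (integrable_slowAverage_integrand hc hB y).1
  · refine Filter.Eventually.of_forall fun z => ?_
    rw [norm_mul, Real.norm_of_nonneg (slowKernel_pos z).le]
    exact mul_le_mul_of_nonneg_right (hB _) (slowKernel_pos z).le

/-- Tonelli and translation invariance. Stated for lower integrals so that it feeds directly into
sums of cube masses in `ℝ≥0∞`. -/
theorem lintegral_slowAverage (hc : Continuous f) (hB : ∀ x, |f x| ≤ B) (h0 : ∀ x, 0 ≤ f x)
    (hf : Integrable f) :
    ∫⁻ y, ENNReal.ofReal (slowAverage f y) =
      ENNReal.ofReal ((∫ z, slowKernel (d := d) z) * ∫ x, f x) := by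
  have h1 : ∀ y, ENNReal.ofReal (slowAverage f y) =
      ∫⁻ z, ENNReal.ofReal (f (y + z)) * ENNReal.ofReal (slowKernel z) := by
    intro y
    unfold slowAverage
    rw [ofReal_integral_eq_lintegral_ofReal (integrable_slowAverage_integrand hc hB y)
      (Filter.Eventually.of_forall fun z => mul_nonneg (h0 _) (slowKernel_pos z).le)]
    simp_rw [ENNReal.ofReal_mul (h0 _)]
  simp_rw [h1]
  have hK : Measurable fun z : EuclideanSpace ℝ (Fin d) => ENNReal.ofReal (slowKernel z) :=
    continuous_slowKernel.measurable.ennreal_ofReal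
  have hF : Measurable fun p : EuclideanSpace ℝ (Fin d) × EuclideanSpace ℝ (Fin d) =>
      ENNReal.ofReal (f (p.1 + p.2)) :=
    (hc.comp (continuous_fst.add continuous_snd)).measurable.ennreal_ofReal
  rw [lintegral_lintegral_swap (hF.mul (hK.comp measurable_snd)).aemeasurable]
  have h2 : ∀ z : EuclideanSpace ℝ (Fin d),
      ∫⁻ y, ENNReal.ofReal (f (y + z)) * ENNReal.ofReal (slowKernel z) =
        (∫⁻ y, ENNReal.ofReal (f y)) * ENNReal.ofReal (slowKernel z) := by
    intro z
    rw [lintegral_mul_const' _ _ ENNReal.ofReal_ne_top,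
      lintegral_add_right_eq_self (fun y => ENNReal.ofReal (f y)) z]
  simp_rw [h2]
  rw [lintegral_const_mul _ hK, ← ofReal_integral_eq_lintegral_ofReal hf
      (Filter.Eventually.of_forall h0), ← ofReal_integral_eq_lintegral_ofReal integrable_slowKernel
      (Filter.Eventually.of_forall fun z => (slowKernel_pos z).le),
    ← ENNReal.ofReal_mul (integral_nonneg h0), mul_comm]

end Kernel

/-! ### Convolution estimates for averaged densities -/

section Convolution

variable {d : ℕ} {f F : EuclideanSpace ℝ (Fin d) → ℂ} {B : ℝ}

/-- Weighted AM-GM inside the convolution. The free `ε` allows the first term to be absorbed when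
the convolution reproduces `f` itself. -/
theorem norm_mul_norm_convolution_le (hc : Continuous f) (hB : ∀ x, ‖f x‖ ≤ B)
    (g : 𝓢(EuclideanSpace ℝ (Fin d), ℂ)) {ε : ℝ} (hε : 0 < ε) (x : EuclideanSpace ℝ (Fin d)) :
    ‖f x‖ * ‖∫ w, f (x - w) * g w‖ ≤
      ε / 2 * (∫ w, ‖g w‖) * ‖f x‖ ^ 2 + (2 * ε)⁻¹ * ∫ w, ‖f (x - w)‖ ^ 2 * ‖g w‖ := by
  have hg : Integrable fun w => ‖g w‖ := g.integrable.norm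
  have i1 : Integrable fun w => ‖f (x - w)‖ * ‖g w‖ :=
    integrable_mul_of_bounded (B := B) hg (by fun_prop) fun w => by simpa using hB _
  have i2 : Integrable fun w => ‖f (x - w)‖ ^ 2 * ‖g w‖ :=
    integrable_mul_of_bounded (B := B ^ 2) hg (by fun_prop) fun w => by
      simpa using pow_le_pow_left₀ (norm_nonneg _) (hB _) 2
  have h1 : ‖∫ w, f (x - w) * g w‖ ≤ ∫ w, ‖f (x - w)‖ * ‖g w‖ := by
    refine (norm_integral_le_integral_norm _).trans_eq ?_
    simp_rw [norm_mul]
  refine (mul_le_mul_of_nonneg_left h1 (norm_nonneg _)).trans ?_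
  rw [← integral_const_mul, mul_right_comm, ← integral_const_mul, ← integral_const_mul,
    ← integral_add (hg.const_mul _) (i2.const_mul _)]
  refine integral_mono (i1.const_mul _) ((hg.const_mul _).add (i2.const_mul _)) fun w => ?_
  have h2 : ‖f x‖ * ‖f (x - w)‖ ≤ ε / 2 * ‖f x‖ ^ 2 + (2 * ε)⁻¹ * ‖f (x - w)‖ ^ 2 := by
    have h3 : ε / 2 * ‖f x‖ ^ 2 + (2 * ε)⁻¹ * ‖f (x - w)‖ ^ 2 - ‖f x‖ * ‖f (x - w)‖ =
        (2 * ε)⁻¹ * (ε * ‖f x‖ - ‖f (x - w)‖) ^ 2 := by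
      field_simp
      ring
    have h4 : 0 ≤ (2 * ε)⁻¹ * (ε * ‖f x‖ - ‖f (x - w)‖) ^ 2 := by positivity
    linarith
  have := mul_le_mul_of_nonneg_right h2 (norm_nonneg (g w))
  simp only
  linarith

theorem SchwartzMap.exists_norm_le_slowKernel (g : 𝓢(EuclideanSpace ℝ (Fin d), ℂ)) (k : ℕ) :
    ∃ C : ℝ, 0 ≤ C ∧ ∀ w, (1 + ‖w‖) ^ k * ‖g w‖ ≤ C * slowKernel w := by
  have h := fun w => SchwartzMap.one_add_le_sup_seminorm_apply (𝕜 := ℂ) (m := (k + (d + 1), 0))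
    (k := k + (d + 1)) (n := 0) le_rfl le_rfl g w
  refine ⟨_, (by positivity : (0 : ℝ) ≤ (1 + ‖(0 : EuclideanSpace ℝ (Fin d))‖) ^ (k + (d + 1)) *
    ‖iteratedFDeriv ℝ 0 g 0‖).trans (h 0), fun w => ?_⟩
  have h1 := h w
  rw [norm_iteratedFDeriv_zero, pow_add] at h1
  unfold slowKernel
  rw [← div_eq_mul_inv, le_div_iff₀ (by positivity)]
  linarith

/-- Convolution with a Schwartz function is bounded for the averaged density. -/
theorem exists_integral_norm_mul_convolution_le (g : 𝓢(EuclideanSpace ℝ (Fin d), ℂ)) :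
    ∃ C : ℝ, 0 ≤ C ∧ ∀ (f F : EuclideanSpace ℝ (Fin d) → ℂ) (B : ℝ), Continuous f →
      (∀ x, ‖f x‖ ≤ B) → Continuous F → (∀ x, ‖F x‖ ≤ B) →
      (∀ x, F x = ∫ w, f (x - w) * g w) → ∀ y,
      slowAverage (fun x => ‖f x‖ * ‖F x‖) y ≤ C * slowAverage (fun x => ‖f x‖ ^ 2) y := by
  -- The factor `(1 + |w|)^(d+1)` pays for translating the average by `w`; the remaining `slowKernel
  -- w` keeps the integral over `w` finite.
  obtain ⟨C, hC0, hC⟩ := g.exists_norm_le_slowKernel (d + 1)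
  have hg : Integrable fun w => ‖g w‖ := g.integrable.norm
  refine ⟨1 / 2 * (∫ w, ‖g w‖) + (2 * 1)⁻¹ * (C * ∫ w, slowKernel (d := d) w), ?_, ?_⟩
  · have h1 : 0 ≤ ∫ w, ‖g w‖ := integral_nonneg fun _ => norm_nonneg _
    have h2 : 0 ≤ ∫ w, slowKernel (d := d) w := integral_nonneg fun z => (slowKernel_pos z).le
    positivity
  intro f F B hf hB hF hFB hFf y
  have hB2 : ∀ x, |‖f x‖ ^ 2| ≤ B ^ 2 := fun x => by
    simpa using pow_le_pow_left₀ (norm_nonneg _) (hB x) 2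
  have hprod : Integrable (Function.uncurry fun z w =>
      ‖f (y + z - w)‖ ^ 2 * ‖g w‖ * slowKernel z) (volume.prod volume) := by
    have h1 := integrable_slowKernel (d := d).mul_prod hg
    have h2 := h1.bdd_mul (c := B ^ 2)
      (f := fun p : EuclideanSpace ℝ (Fin d) × EuclideanSpace ℝ (Fin d) => ‖f (y + p.1 - p.2)‖ ^ 2)
      (Continuous.aestronglyMeasurable (by fun_prop)) (Filter.Eventually.of_forall fun p => hB2 _)
    refine h2.congr (Filter.Eventually.of_forall fun p => ?_)
    simp only [Function.uncurry]
    ring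
  have i3 := hprod.integral_prod_left
  simp only [Function.uncurry] at i3
  have i1 : Integrable fun z => 1 / 2 * (∫ w, ‖g w‖) * (‖f (y + z)‖ ^ 2 * slowKernel z) :=
    (integrable_slowAverage_integrand (f := fun x => ‖f x‖ ^ 2) (by fun_prop) hB2 y).const_mul _
  have hstep : slowAverage (fun x => ‖f x‖ * ‖F x‖) y ≤
      ∫ z, (1 / 2 * (∫ w, ‖g w‖) * (‖f (y + z)‖ ^ 2 * slowKernel z) +
        (2 * 1)⁻¹ * ∫ w, ‖f (y + z - w)‖ ^ 2 * ‖g w‖ * slowKernel z) := by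
    refine integral_mono ?_ (i1.add (i3.const_mul _)) fun z => ?_
    · refine integrable_slowAverage_integrand (f := fun x => ‖f x‖ * ‖F x‖) (B := B * B)
        (by fun_prop) (fun x => ?_) y
      rw [abs_mul, abs_norm, abs_norm]
      exact mul_le_mul (hB x) (hFB x) (norm_nonneg _) ((norm_nonneg _).trans (hB x))
    · have h := norm_mul_norm_convolution_le hf hB g one_pos (y + z)
      rw [← hFf] at h
      have h' := mul_le_mul_of_nonneg_right h (slowKernel_pos z).le
      simp only
      rw [integral_mul_const]
      linarith
  refine hstep.trans ?_
  rw [integral_add i1 (i3.const_mul _), integral_const_mul, integral_const_mul, add_mul]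
  refine add_le_add le_rfl ?_
  rw [mul_assoc]
  refine mul_le_mul_of_nonneg_left ?_ (by norm_num)
  rw [integral_integral_swap hprod, ← integral_const_mul, ← integral_mul_const]
  refine integral_mono hprod.integral_prod_right
    ((integrable_slowKernel.const_mul C).mul_const _) fun w => ?_
  have h1 : ∫ z, ‖f (y + z - w)‖ ^ 2 * ‖g w‖ * slowKernel z =
      ‖g w‖ * slowAverage (fun x => ‖f x‖ ^ 2) (y - w) := by
    unfold slowAverage
    rw [← integral_const_mul]
    refine integral_congr_ae (Filter.Eventually.of_forall fun z => ?_)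
    simp only [show y + z - w = y - w + z by abel]
    ring
  simp only
  rw [h1]
  have h0 := slowAverage_nonneg (f := fun x => ‖f x‖ ^ 2) (fun x => by positivity) y
  refine (mul_le_mul_of_nonneg_left (slowAverage_sub_le (f := fun x => ‖f x‖ ^ 2) (by fun_prop) hB2
    (fun x => by positivity) y w) (norm_nonneg _)).trans ?_
  have := mul_le_mul_of_nonneg_right (hC w) h0
  linarith

/-- A function reproduced by convolution with a Schwartz function is pointwise controlled by its
averaged density. -/
theorem exists_norm_sq_le_slowAverage (g : 𝓢(EuclideanSpace ℝ (Fin d), ℂ)) :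
    ∃ C : ℝ, 0 ≤ C ∧ ∀ (f : EuclideanSpace ℝ (Fin d) → ℂ) (B : ℝ), Continuous f →
      (∀ x, ‖f x‖ ≤ B) → (∀ x, f x = ∫ w, f (x - w) * g w) → ∀ x,
      ‖f x‖ ^ 2 ≤ C * slowAverage (fun x => ‖f x‖ ^ 2) x := by
  obtain ⟨C, hC0, hC⟩ := g.exists_norm_le_slowKernel 0
  set A := ∫ w, ‖g w‖ with hA
  have hA0 : 0 ≤ A := integral_nonneg fun _ => norm_nonneg _
  refine ⟨(A + 1) * C, by positivity, fun f B hf hB hff x => ?_⟩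
  have hB2 : ∀ x, |‖f x‖ ^ 2| ≤ B ^ 2 := fun x => by
    simpa using pow_le_pow_left₀ (norm_nonneg _) (hB x) 2
  -- With `A = ∫ ‖g‖`, this `ε` makes the first coefficient `εA/2` at most `1/2`, so that term moves
  -- to the left side; the `+ 1` covers `A = 0`.
  have h := norm_mul_norm_convolution_le hf hB g (ε := (A + 1)⁻¹) (by positivity) x
  rw [← hff, ← hA] at h
  set D := ∫ w, ‖f (x - w)‖ ^ 2 * ‖g w‖ with hD
  have h1 : D ≤ C * slowAverage (fun x => ‖f x‖ ^ 2) x := by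
    unfold slowAverage
    rw [← integral_neg_eq_self, ← integral_const_mul]
    simp_rw [← sub_eq_add_neg, slowKernel_neg]
    refine integral_mono ?_ ?_ fun w => ?_
    · exact integrable_mul_of_bounded (B := B ^ 2) g.integrable.norm (by fun_prop) fun w => hB2 _
    · exact (integrable_mul_of_bounded (B := B ^ 2) integrable_slowKernel (by fun_prop)
        fun w => hB2 _).const_mul C
    · have h2 := hC w
      rw [pow_zero, one_mul] at h2
      have := mul_le_mul_of_nonneg_left h2 (sq_nonneg ‖f (x - w)‖)
      simp only
      linarith
  have h3 : (A + 1)⁻¹ / 2 * A * ‖f x‖ ^ 2 ≤ 1 / 2 * ‖f x‖ ^ 2 := by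
    refine mul_le_mul_of_nonneg_right ?_ (sq_nonneg _)
    rw [div_mul_eq_mul_div, inv_mul_eq_div]
    have : A / (A + 1) ≤ 1 := (div_le_one (by positivity)).2 (by linarith)
    linarith
  have h4 : (2 * (A + 1)⁻¹)⁻¹ = (A + 1) / 2 := by
    field_simp
  rw [h4] at h
  have h5 : ‖f x‖ ^ 2 ≤ (A + 1) * D := by nlinarith
  calc ‖f x‖ ^ 2 ≤ (A + 1) * D := h5
    _ ≤ (A + 1) * (C * slowAverage (fun x => ‖f x‖ ^ 2) x) :=
        mul_le_mul_of_nonneg_left h1 (by positivity)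
    _ = _ := by ring

end Convolution

/-! ### The averaged density and current of a wave -/

section Density

variable {d : ℕ}

theorem hasDerivAt_slowAverage {f f' : ℝ → EuclideanSpace ℝ (Fin d) → ℝ} {B B' : ℝ}
    (hf : ∀ s, Continuous (f s)) (hf' : ∀ s, Continuous (f' s)) (hB : ∀ s x, |f s x| ≤ B)
    (hB' : ∀ s x, |f' s x| ≤ B') (hder : ∀ s x, HasDerivAt (fun s => f s x) (f' s x) s) (s : ℝ)
    (y : EuclideanSpace ℝ (Fin d)) :
    HasDerivAt (fun s => slowAverage (f s) y) (slowAverage (f' s) y) s := by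
  refine (hasDerivAt_integral_of_dominated_loc_of_deriv_le (s := Set.univ)
    (F' := fun s z => f' s (y + z) * slowKernel z)
    (bound := fun z => B' * slowKernel z) Filter.univ_mem
    (Filter.Eventually.of_forall fun s => (integrable_slowAverage_integrand (hf s) (hB s) y).1)
    (integrable_slowAverage_integrand (hf s) (hB s) y)
    (integrable_slowAverage_integrand (hf' s) (hB' s) y).1 ?_
    (integrable_slowKernel.const_mul B') ?_).2
  · refine Filter.Eventually.of_forall fun z r _ => ?_
    rw [norm_mul, Real.norm_of_nonneg (slowKernel_pos z).le]
    exact mul_le_mul_of_nonneg_right (hB' _ _) (slowKernel_pos z).le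
  · exact Filter.Eventually.of_forall fun z r _ => (hder r (y + z)).mul_const _

/-- The frequency profile of the derivative of a wave in direction `v`. -/
noncomputable def profileDeriv (v : EuclideanSpace ℝ (Fin d)) (a : EuclideanSpace ℝ (Fin d) → ℂ) :
    EuclideanSpace ℝ (Fin d) → ℂ :=
  fun ξ => Complex.I * ((2 * Real.pi * inner ℝ v ξ : ℝ) : ℂ) * a ξ

/-- The frequency profile of the time derivative of a wave. -/
noncomputable def profileTimeDeriv (a : EuclideanSpace ℝ (Fin d) → ℂ) :
    EuclideanSpace ℝ (Fin d) → ℂ :=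
  fun ξ => Complex.I * ((-(4 * Real.pi ^ 2 * ‖ξ‖ ^ 2) : ℝ) : ℂ) * a ξ

/-- The averaged mass density of a wave. -/
noncomputable def waveDensity (a : EuclideanSpace ℝ (Fin d) → ℂ) (t : ℝ) :
    EuclideanSpace ℝ (Fin d) → ℝ :=
  slowAverage fun x => ‖wave a t x‖ ^ 2

/-- The averaged mass current of a wave in direction `v`. -/
noncomputable def waveCurrent (v : EuclideanSpace ℝ (Fin d)) (a : EuclideanSpace ℝ (Fin d) → ℂ)
    (t : ℝ) : EuclideanSpace ℝ (Fin d) → ℝ :=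
  slowAverage fun x => 2 * ((starRingEnd ℂ) (wave a t x) * wave (profileDeriv v a) t x).im

variable {a : EuclideanSpace ℝ (Fin d) → ℂ}

theorem IsProfile.profileDeriv (ha : IsProfile a) (v : EuclideanSpace ℝ (Fin d)) :
    IsProfile (profileDeriv v a) :=
  ha.mul (f := fun ξ => Complex.I * ((2 * Real.pi * inner ℝ v ξ : ℝ) : ℂ)) (by fun_prop)

theorem IsProfile.profileTimeDeriv (ha : IsProfile a) : IsProfile (profileTimeDeriv a) :=
  ha.mul (f := fun ξ => Complex.I * ((-(4 * Real.pi ^ 2 * ‖ξ‖ ^ 2) : ℝ) : ℂ)) (by fun_prop)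

theorem norm_conj_wave_mul_wave_le (a b : EuclideanSpace ℝ (Fin d) → ℂ) (t : ℝ)
    (x : EuclideanSpace ℝ (Fin d)) :
    ‖(starRingEnd ℂ) (wave a t x) * wave b t x‖ ≤ (∫ ξ, ‖a ξ‖) * ∫ ξ, ‖b ξ‖ := by
  rw [norm_mul, RCLike.norm_conj]
  exact mul_le_mul (norm_wave_le t x) (norm_wave_le t x) (norm_nonneg _)
    (integral_nonneg fun _ => norm_nonneg _)

theorem abs_two_mul_im_le (a b : EuclideanSpace ℝ (Fin d) → ℂ) (t : ℝ)
    (x : EuclideanSpace ℝ (Fin d)) :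
    |2 * ((starRingEnd ℂ) (wave a t x) * wave b t x).im| ≤
      2 * ((∫ ξ, ‖a ξ‖) * ∫ ξ, ‖b ξ‖) := by
  rw [abs_mul, abs_two]
  exact mul_le_mul_of_nonneg_left
    ((Complex.abs_im_le_norm _).trans (norm_conj_wave_mul_wave_le a b t x)) zero_le_two

theorem abs_two_mul_re_le (a b : EuclideanSpace ℝ (Fin d) → ℂ) (t : ℝ)
    (x : EuclideanSpace ℝ (Fin d)) :
    |2 * ((starRingEnd ℂ) (wave a t x) * wave b t x).re| ≤
      2 * ((∫ ξ, ‖a ξ‖) * ∫ ξ, ‖b ξ‖) := by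
  rw [abs_mul, abs_two]
  exact mul_le_mul_of_nonneg_left
    ((Complex.abs_re_le_norm _).trans (norm_conj_wave_mul_wave_le a b t x)) zero_le_two

theorem abs_norm_wave_sq_le (a : EuclideanSpace ℝ (Fin d) → ℂ) (t : ℝ)
    (x : EuclideanSpace ℝ (Fin d)) : |‖wave a t x‖ ^ 2| ≤ (∫ ξ, ‖a ξ‖) ^ 2 := by
  rw [abs_pow, abs_norm]
  exact pow_le_pow_left₀ (norm_nonneg _) (norm_wave_le t x) 2

theorem continuous_conj_wave_mul_wave {b : EuclideanSpace ℝ (Fin d) → ℂ} (ha : IsProfile a)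
    (hb : IsProfile b) (t : ℝ) :
    Continuous fun x => (starRingEnd ℂ) (wave a t x) * wave b t x :=
  (Complex.continuous_conj.comp (continuous_wave_right ha t)).mul (continuous_wave_right hb t)

theorem continuous_two_mul_im {b : EuclideanSpace ℝ (Fin d) → ℂ} (ha : IsProfile a)
    (hb : IsProfile b) (t : ℝ) :
    Continuous fun x => 2 * ((starRingEnd ℂ) (wave a t x) * wave b t x).im :=
  continuous_const.mul (Complex.continuous_im.comp (continuous_conj_wave_mul_wave ha hb t))

theorem continuous_two_mul_re {b : EuclideanSpace ℝ (Fin d) → ℂ} (ha : IsProfile a)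
    (hb : IsProfile b) (t : ℝ) :
    Continuous fun x => 2 * ((starRingEnd ℂ) (wave a t x) * wave b t x).re :=
  continuous_const.mul (Complex.continuous_re.comp (continuous_conj_wave_mul_wave ha hb t))

theorem continuous_norm_wave_sq (ha : IsProfile a) (t : ℝ) : Continuous fun x => ‖wave a t x‖ ^ 2 :=
  (continuous_wave_right ha t).norm.pow 2

theorem continuous_waveDensity (ha : IsProfile a) (t : ℝ) : Continuous (waveDensity a t) :=
  continuous_slowAverage (continuous_norm_wave_sq ha t) (abs_norm_wave_sq_le a t)

theorem waveDensity_nonneg (a : EuclideanSpace ℝ (Fin d) → ℂ) (t : ℝ)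
    (y : EuclideanSpace ℝ (Fin d)) : 0 ≤ waveDensity a t y :=
  slowAverage_nonneg (f := fun x => ‖wave a t x‖ ^ 2) (fun _ => sq_nonneg _) y

theorem hasDerivAt_waveDensity (ha : IsProfile a) (t : ℝ) (y : EuclideanSpace ℝ (Fin d)) :
    HasDerivAt (fun t => waveDensity a t y)
      (slowAverage (fun x =>
        2 * ((starRingEnd ℂ) (wave a t x) * wave (profileTimeDeriv a) t x).re) y) t := by
  refine hasDerivAt_slowAverage (f := fun t x => ‖wave a t x‖ ^ 2)
    (f' := fun t x => 2 * ((starRingEnd ℂ) (wave a t x) * wave (profileTimeDeriv a) t x).re)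
    (continuous_norm_wave_sq ha)
    (fun t => continuous_two_mul_re ha ha.profileTimeDeriv t)
    (fun t => abs_norm_wave_sq_le a t) (fun t => abs_two_mul_re_le a _ t) (fun t x => ?_) t y
  have h := (hasDerivAt_wave_time ha t x).norm_sq
  refine h.congr_deriv ?_
  rw [Complex.inner, mul_comm (wave _ t x)]
  rfl

theorem hasLineDerivAt_waveCurrent (ha : IsProfile a) (v : EuclideanSpace ℝ (Fin d)) (t : ℝ)
    (y : EuclideanSpace ℝ (Fin d)) :
    HasLineDerivAt ℝ (waveCurrent v a t)
      (slowAverage (fun x =>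
        2 * ((starRingEnd ℂ) (wave a t x) * wave (profileDeriv v (profileDeriv v a)) t x).im) y)
      y v := by
  have h := hasDerivAt_slowAverage
    (f := fun s x =>
      2 * ((starRingEnd ℂ) (wave a t (x + s • v)) * wave (profileDeriv v a) t (x + s • v)).im)
    (f' := fun s x => 2 * ((starRingEnd ℂ) (wave a t (x + s • v)) *
      wave (profileDeriv v (profileDeriv v a)) t (x + s • v)).im)
    (fun s => (continuous_two_mul_im ha (ha.profileDeriv v) t).comp
      (continuous_id.add continuous_const))
    (fun s => (continuous_two_mul_im ha ((ha.profileDeriv v).profileDeriv v) t).comp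
      (continuous_id.add continuous_const))
    (fun s x => abs_two_mul_im_le a _ t _) (fun s x => abs_two_mul_im_le a _ t _) (fun s x => ?_) 0 y
  · simp only [zero_smul, add_zero] at h
    unfold HasLineDerivAt
    refine h.congr_of_eventuallyEq (Filter.Eventually.of_forall fun s => ?_)
    simp only [waveCurrent, slowAverage, add_right_comm y _ (s • v)]
  · have h1 := hasDerivAt_wave_space ha t x v s
    have h2 := hasDerivAt_wave_space (ha.profileDeriv v) t x v s
    have h3 : HasDerivAt (fun s : ℝ => (starRingEnd ℂ) (wave a t (x + s • v)))
        ((starRingEnd ℂ) (wave (profileDeriv v a) t (x + s • v))) s := h1.star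
    have h4 := (Complex.imCLM.hasFDerivAt.comp_hasDerivAt s (h3.mul h2)).const_mul 2
    refine h4.congr_deriv ?_
    change 2 * ((starRingEnd ℂ) (wave (profileDeriv v a) t (x + s • v)) *
      wave (profileDeriv v a) t (x + s • v) + (starRingEnd ℂ) (wave a t (x + s • v)) *
      wave (profileDeriv v (profileDeriv v a)) t (x + s • v)).im = _
    -- The term `conj(∂u) ∂u` is real, so only the second derivative of `u` survives in the
    -- imaginary part.
    rw [← Complex.normSq_eq_conj_mul_self, Complex.add_im, Complex.ofReal_im, zero_add]

theorem wave_sum {ι : Type*} (s : Finset ι) {b : ι → EuclideanSpace ℝ (Fin d) → ℂ}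
    (hb : ∀ i, IsProfile (b i)) (t : ℝ) (x : EuclideanSpace ℝ (Fin d)) :
    wave (fun ξ => ∑ i ∈ s, b i ξ) t x = ∑ i ∈ s, wave (b i) t x := by
  unfold wave
  simp_rw [Finset.mul_sum]
  refine integral_finsetSum _ fun i _ => ?_
  exact (hb i).integrable.norm.mono' (aestronglyMeasurable_wave_integrand (hb i) t x)
    (Filter.Eventually.of_forall fun ξ => (norm_wave_integrand t x ξ).le)

/-- The equation `∂ₜu = iΔu` for waves: both sides have the same frequency profile. -/
theorem wave_profileTimeDeriv (ha : IsProfile a) (t : ℝ) (x : EuclideanSpace ℝ (Fin d)) :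
    wave (profileTimeDeriv a) t x = Complex.I * ∑ j,
      wave (profileDeriv (EuclideanSpace.basisFun (Fin d) ℝ j)
        (profileDeriv (EuclideanSpace.basisFun (Fin d) ℝ j) a)) t x := by
  rw [← wave_sum _ fun j => (ha.profileDeriv _).profileDeriv _]
  unfold wave
  rw [← integral_const_mul]
  refine integral_congr_ae (Filter.Eventually.of_forall fun ξ => ?_)
  have h : ∑ j, profileDeriv (EuclideanSpace.basisFun (Fin d) ℝ j)
      (profileDeriv (EuclideanSpace.basisFun (Fin d) ℝ j) a) ξ =
      ((-(4 * Real.pi ^ 2 * ‖ξ‖ ^ 2) : ℝ) : ℂ) * a ξ := by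
    rw [← (EuclideanSpace.basisFun (Fin d) ℝ).sum_sq_inner_right ξ]
    push_cast
    rw [Finset.mul_sum, ← Finset.sum_neg_distrib, Finset.sum_mul]
    refine Finset.sum_congr rfl fun j _ => ?_
    simp only [profileDeriv]
    push_cast
    linear_combination (4 * Real.pi ^ 2 *
      (inner ℝ (EuclideanSpace.basisFun (Fin d) ℝ j) ξ : ℂ) ^ 2 * a ξ) * Complex.I_sq
  simp only
  rw [h, profileTimeDeriv]
  ring

theorem slowAverage_sum {ι : Type*} (s : Finset ι) {f : ι → EuclideanSpace ℝ (Fin d) → ℝ}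
    {B : ι → ℝ} (hf : ∀ i, Continuous (f i)) (hB : ∀ i x, |f i x| ≤ B i)
    (y : EuclideanSpace ℝ (Fin d)) :
    slowAverage (fun x => ∑ i ∈ s, f i x) y = ∑ i ∈ s, slowAverage (f i) y := by
  unfold slowAverage
  simp_rw [Finset.sum_mul]
  exact integral_finsetSum _ fun i _ => integrable_slowAverage_integrand (hf i) (hB i) y

/-- Conservation of mass. -/
theorem slowAverage_continuity_equation (ha : IsProfile a) (t : ℝ)
    (y : EuclideanSpace ℝ (Fin d)) :
    slowAverage (fun x =>
        2 * ((starRingEnd ℂ) (wave a t x) * wave (profileTimeDeriv a) t x).re) y =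
      -∑ j, slowAverage (fun x => 2 * ((starRingEnd ℂ) (wave a t x) *
        wave (profileDeriv (EuclideanSpace.basisFun (Fin d) ℝ j)
          (profileDeriv (EuclideanSpace.basisFun (Fin d) ℝ j) a)) t x).im) y := by
  rw [← slowAverage_sum _ (fun j => continuous_two_mul_im ha ((ha.profileDeriv _).profileDeriv _) t)
      (fun j => abs_two_mul_im_le a _ t)]
  unfold slowAverage
  rw [← integral_neg]
  refine integral_congr_ae (Filter.Eventually.of_forall fun z => ?_)
  simp only
  rw [wave_profileTimeDeriv ha, ← Finset.mul_sum, ← Complex.im_sum, ← Finset.mul_sum,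
    mul_left_comm, Complex.I_mul_re]
  ring

theorem exists_schwartz_eq_one_on_unit_ball (d : ℕ) :
    ∃ χ : 𝓢(EuclideanSpace ℝ (Fin d), ℂ), ∀ ξ, ‖ξ‖ ≤ 1 → χ ξ = 1 := by
  let φ : ContDiffBump (0 : EuclideanSpace ℝ (Fin d)) := ⟨1, 2, one_pos, one_lt_two⟩
  refine ⟨HasCompactSupport.toSchwartzMap (f := fun ξ => (φ ξ : ℂ))
    (φ.hasCompactSupport.comp_left (g := fun r : ℝ => (r : ℂ)) (by simp))
    (Complex.ofRealCLM.contDiff.comp φ.contDiff), fun ξ hξ => ?_⟩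
  change ((φ ξ : ℝ) : ℂ) = 1
  rw [φ.one_of_mem_closedBall (by simpa using hξ), Complex.ofReal_one]

/-- The averaged density dominates the pointwise density and the averaged current. -/
theorem exists_waveDensity_bounds (d : ℕ) :
    ∃ V C : ℝ, 0 < V ∧ 0 < C ∧ ∀ a : EuclideanSpace ℝ (Fin d) → ℂ, IsProfile a → ∀ t x,
      ∑ j, |waveCurrent (EuclideanSpace.basisFun (Fin d) ℝ j) a t x| ≤ V * waveDensity a t x ∧
      ‖wave a t x‖ ^ 2 ≤ C * waveDensity a t x := by
  obtain ⟨χ, hχ⟩ := exists_schwartz_eq_one_on_unit_ball d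
  have hq : ∀ v : EuclideanSpace ℝ (Fin d), (fun ξ : EuclideanSpace ℝ (Fin d) =>
      Complex.I * ((2 * Real.pi * inner ℝ v ξ : ℝ) : ℂ)).HasTemperateGrowth := by
    intro v
    fun_prop
  -- Since `χ = 1` on the support of every profile, convolution with `𝓕⁻ χ` reproduces the wave and
  -- with `𝓕⁻ (χ' j)` gives its `j`-th derivative. These kernels do not depend on `a`, nor then do
  -- the constants.
  let χ' : Fin d → 𝓢(EuclideanSpace ℝ (Fin d), ℂ) := fun j =>
    SchwartzMap.smulLeftCLM ℂ (fun ξ => Complex.I *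
      ((2 * Real.pi * inner ℝ (EuclideanSpace.basisFun (Fin d) ℝ j) ξ : ℝ) : ℂ)) χ
  choose c hc0 hc using fun j => exists_integral_norm_mul_convolution_le (𝓕⁻ (χ' j))
  obtain ⟨C, hC0, hC⟩ := exists_norm_sq_le_slowAverage (𝓕⁻ χ)
  have hsum : 0 ≤ ∑ j, c j := Finset.sum_nonneg fun j _ => hc0 j
  refine ⟨2 * (∑ j, c j) + 1, C + 1, by positivity, by positivity, fun a ha t x => ?_⟩
  have hρ : 0 ≤ waveDensity a t x := waveDensity_nonneg a t x
  constructor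
  · have h1 : ∀ j, |waveCurrent (EuclideanSpace.basisFun (Fin d) ℝ j) a t x| ≤
        2 * (c j * waveDensity a t x) := by
      intro j
      set b := profileDeriv (EuclideanSpace.basisFun (Fin d) ℝ j) a with hb
      have hbP : IsProfile b := ha.profileDeriv _
      set B := max (∫ ξ, ‖a ξ‖) (∫ ξ, ‖b ξ‖)
      have hrep : ∀ x, wave b t x = ∫ w, wave a t (x - w) * (𝓕⁻ (χ' j)) w := by
        intro x
        rw [← wave_mul_eq_integral ha]
        congr 1
        funext ξ
        simp only [χ', SchwartzMap.smulLeftCLM_apply_apply (hq _), hb, profileDeriv, smul_eq_mul]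
        by_cases hξ : ‖ξ‖ ≤ 1
        · rw [hχ ξ hξ, mul_one]
        · simp [ha.eq_zero ξ (not_le.1 hξ)]
      have h2 := hc j (wave a t) (wave b t) B (continuous_wave_right ha t)
        (fun x => (norm_wave_le t x).trans (le_max_left _ _)) (continuous_wave_right hbP t)
        (fun x => (norm_wave_le t x).trans (le_max_right _ _)) hrep x
      refine le_trans ?_ (mul_le_mul_of_nonneg_left h2 zero_le_two)
      unfold waveCurrent slowAverage
      rw [← integral_const_mul, ← Real.norm_eq_abs]
      refine norm_integral_le_of_norm_le (Integrable.const_mul ?_ 2)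
        (Filter.Eventually.of_forall fun z => ?_)
      · refine integrable_slowAverage_integrand (f := fun x => ‖wave a t x‖ * ‖wave b t x‖)
          (B := (∫ ξ, ‖a ξ‖) * ∫ ξ, ‖b ξ‖)
          ((continuous_wave_right ha t).norm.mul (continuous_wave_right hbP t).norm) (fun x => ?_) x
        have := norm_conj_wave_mul_wave_le a b t x
        rw [norm_mul, RCLike.norm_conj] at this
        rwa [abs_mul, abs_norm, abs_norm]
      · rw [norm_mul, Real.norm_of_nonneg (slowKernel_pos z).le, Real.norm_eq_abs, abs_mul, abs_two,
          mul_assoc]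
        refine mul_le_mul_of_nonneg_left (mul_le_mul_of_nonneg_right ?_ (slowKernel_pos z).le)
          zero_le_two
        refine (Complex.abs_im_le_norm _).trans_eq ?_
        rw [norm_mul, RCLike.norm_conj]
    refine (Finset.sum_le_sum fun j _ => h1 j).trans ?_
    rw [← Finset.mul_sum, ← Finset.sum_mul]
    linarith
  · have hrep : ∀ x, wave a t x = ∫ w, wave a t (x - w) * (𝓕⁻ χ) w := by
      intro x
      rw [← wave_mul_eq_integral ha]
      congr 1
      funext ξ
      by_cases hξ : ‖ξ‖ ≤ 1
      · rw [hχ ξ hξ, one_mul]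
      · simp [ha.eq_zero ξ (not_le.1 hξ)]
    have h1 := hC (wave a t) _ (continuous_wave_right ha t) (norm_wave_le t) hrep x
    refine h1.trans (mul_le_mul_of_nonneg_right ?_ hρ)
    linarith

end Density

/-! ### Finite speed of propagation -/

section FiniteSpeed

variable {d : ℕ}

open scoped Convolution in
/-- A smooth substitute for the distance to a set. -/
theorem exists_smooth_infDist (S : Set (EuclideanSpace ℝ (Fin d))) :
    ∃ g : EuclideanSpace ℝ (Fin d) → ℝ, ContDiff ℝ 1 g ∧ (∀ y, ‖fderiv ℝ g y‖ ≤ 1) ∧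
      (∀ y ∈ S, g y ≤ 0) ∧ ∀ y, Metric.infDist y S - 2 ≤ g y := by
  -- The bump is supported in the unit ball, so mollifying the 1-Lipschitz distance moves it by at
  -- most 1. Subtracting 1 makes it nonpositive on `S`, for a total loss of 2.
  let φ : ContDiffBump (0 : EuclideanSpace ℝ (Fin d)) := ⟨1 / 2, 1, by norm_num, by norm_num⟩
  set D : EuclideanSpace ℝ (Fin d) → ℝ := fun y => Metric.infDist y S with hD
  have hDc : Continuous D := Metric.continuous_infDist_pt S
  have hDL : ∀ x y, |D x - D y| ≤ dist x y := fun x y => by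
    simpa [Real.dist_eq] using (Metric.lipschitz_infDist_pt S).dist_le_mul x y
  set G := MeasureTheory.convolution (φ.normed volume) D (ContinuousLinearMap.lsmul ℝ ℝ) volume with hG
  have hGd : ContDiff ℝ 1 G :=
    φ.hasCompactSupport_normed.contDiff_convolution_left _ φ.contDiff_normed hDc.locallyIntegrable
  have hclose : ∀ y, |G y - D y| ≤ 1 := by
    intro y
    rw [← Real.dist_eq]
    refine φ.dist_normed_convolution_le hDc.aestronglyMeasurable fun x hx => ?_
    rw [Real.dist_eq]
    exact (hDL x y).trans (Metric.mem_ball.1 hx).le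
  have hint : ∀ y, Integrable fun z => φ.normed volume z * D (y - z) := by
    intro y
    refine Continuous.integrable_of_hasCompactSupport
      (φ.continuous_normed.mul (hDc.comp (continuous_const.sub continuous_id))) ?_
    exact φ.hasCompactSupport_normed.mul_right
  have hlip : LipschitzWith 1 G := by
    refine LipschitzWith.of_dist_le_mul fun x y => ?_
    rw [NNReal.coe_one, one_mul, Real.dist_eq]
    have h1 : G x - G y = ∫ z, φ.normed volume z * (D (x - z) - D (y - z)) := by
      simp_rw [mul_sub]
      rw [integral_sub (hint x) (hint y)]
      rfl
    rw [h1, ← Real.norm_eq_abs]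
    have h2 : dist x y = ∫ z, φ.normed volume z * dist x y := by
      rw [integral_mul_const, φ.integral_normed, one_mul]
    rw [h2]
    refine norm_integral_le_of_norm_le (φ.integrable_normed.mul_const _)
      (Filter.Eventually.of_forall fun z => ?_)
    rw [norm_mul, Real.norm_of_nonneg (φ.nonneg_normed z)]
    refine mul_le_mul_of_nonneg_left ((hDL _ _).trans ?_) (φ.nonneg_normed z)
    rw [dist_sub_right]
  refine ⟨fun y => G y - 1, hGd.sub contDiff_const, fun y => ?_, fun y hy => ?_, fun y => ?_⟩
  · rw [fderiv_sub_const]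
    simpa using norm_fderiv_le_of_lipschitz ℝ hlip (x₀ := y)
  · have h1 := abs_le.1 (hclose y)
    have h2 : D y = 0 := Metric.infDist_zero_of_mem hy
    linarith [h1.2]
  · have h1 := abs_le.1 (hclose y)
    simp only [hD] at h1
    linarith [h1.1]

theorem hasDerivAt_smoothTransition (t : ℝ) :
    HasDerivAt Real.smoothTransition (deriv Real.smoothTransition t) t :=
  ((Real.smoothTransition.contDiff (n := 1)).differentiable one_ne_zero t).hasDerivAt

/-- Mass obeying a continuity equation with current at most `V` times the density propagates with
finite speed. -/
theorem integral_le_of_continuity_equation {ρ ρ' : ℝ → EuclideanSpace ℝ (Fin d) → ℝ}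
    {J J' : Fin d → ℝ → EuclideanSpace ℝ (Fin d) → ℝ} {B V : ℝ} (hV : 0 ≤ V)
    (hρc : ∀ t, Continuous (ρ t)) (hρ'c : ∀ t, Continuous (ρ' t))
    (hJc : ∀ j t, Continuous (J j t)) (hJ'c : ∀ j t, Continuous (J' j t))
    (hρ0 : ∀ t y, 0 ≤ ρ t y) (hρB : ∀ t y, |ρ t y| ≤ B) (hρ'B : ∀ t y, |ρ' t y| ≤ B)
    (hρd : ∀ t y, HasDerivAt (fun t => ρ t y) (ρ' t y) t)
    (hJd : ∀ j t y,
      HasLineDerivAt ℝ (J j t) (J' j t y) y (EuclideanSpace.basisFun (Fin d) ℝ j))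
    (hdiv : ∀ t y, ρ' t y = -∑ j, J' j t y) (hJV : ∀ t y, ∑ j, |J j t y| ≤ V * ρ t y)
    {S : Set (EuclideanSpace ℝ (Fin d))} (hS : Bornology.IsBounded S) (hSm : MeasurableSet S)
    (hSne : S.Nonempty)
    {s t L : ℝ} (hst : s ≤ t) (hL : 3 + V * (t - s) ≤ L) :
    ∫ y in S, ρ s y ≤ ∫ y in Metric.thickening L S, ρ t y := by
  obtain ⟨g, hg, hgd, hgS, hgD⟩ := exists_smooth_infDist S
  obtain ⟨c, -, hc⟩ := Real.exists_abs_deriv_smoothTransition_le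
  set e := EuclideanSpace.basisFun (Fin d) ℝ with he
  -- The cutoff `φ` is 1 where `g ≤ V(τ - s)` and 0 where `g ≥ 1 + V(τ - s)`: a front of width 1
  -- moving outward at speed `V`. The aim is that the mass weighted by `φ` cannot decrease.
  set θ : ℝ → EuclideanSpace ℝ (Fin d) → ℝ := fun τ y => 1 - (g y - V * (τ - s)) with hθ
  set φ : ℝ → EuclideanSpace ℝ (Fin d) → ℝ := fun τ y => Real.smoothTransition (θ τ y) with hφ
  set k : ℝ → EuclideanSpace ℝ (Fin d) → ℝ := fun τ y => deriv Real.smoothTransition (θ τ y) with hk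
  have hgc : Continuous g := hg.continuous
  have hθc : ∀ τ, Continuous (θ τ) := fun τ => by
    simp only [hθ]; fun_prop
  have hφc : ∀ τ, Continuous (φ τ) := fun τ =>
    Real.smoothTransition.continuous.comp (hθc τ)
  have hkc : ∀ τ, Continuous (k τ) := fun τ =>
    ((Real.smoothTransition.contDiff (n := 1)).continuous_deriv le_rfl).comp (hθc τ)
  have hk0 : ∀ τ y, 0 ≤ k τ y := fun τ y => Real.smoothTransition.monotone.deriv_nonneg
  have hφt : ∀ τ y, HasDerivAt (fun τ => φ τ y) (k τ y * V) τ := by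
    intro τ y
    have h1 : HasDerivAt (fun τ => θ τ y) V τ := by
      have := ((((hasDerivAt_id τ).sub_const s).const_mul V).const_sub (g y)).const_sub 1
      simpa [hθ] using this
    exact (hasDerivAt_smoothTransition (θ τ y)).comp τ h1
  have hφx : ∀ j τ y, HasLineDerivAt ℝ (φ τ) (-(k τ y * fderiv ℝ g y (e j))) y (e j) := by
    intro j τ y
    have h1 : HasFDerivAt g (fderiv ℝ g y) y := (hg.differentiable one_ne_zero y).hasFDerivAt
    have h2 : HasDerivAt (fun r : ℝ => g (y + r • e j)) (fderiv ℝ g y (e j)) 0 :=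
      h1.hasLineDerivAt (e j)
    have h3 : HasDerivAt (fun r : ℝ => θ τ (y + r • e j)) (-(fderiv ℝ g y (e j))) 0 := by
      have := (h2.sub_const (V * (τ - s))).const_sub 1
      simpa [hθ] using this
    have h4 : HasDerivAt Real.smoothTransition (k τ y) (θ τ (y + (0 : ℝ) • e j)) := by
      rw [zero_smul, add_zero]
      exact hasDerivAt_smoothTransition (θ τ y)
    have h5 := h4.comp (0 : ℝ) h3
    rw [mul_neg] at h5
    exact h5
  obtain ⟨R₁, hR₁⟩ := hS.subset_closedBall 0
  have hsupp : ∀ τ R, R₁ + 3 + V * (τ - s) ≤ R → ∀ y, y ∉ Metric.closedBall 0 R →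
      φ τ y = 0 ∧ k τ y = 0 := by
    intro τ R hR y hy
    have h1 : θ τ y ≤ 0 := by
      by_contra! h
      have h2 : Metric.infDist y S < 3 + V * (τ - s) := by
        simp only [hθ] at h
        linarith [hgD y]
      obtain ⟨z, hz, hyz⟩ := (Metric.infDist_lt_iff hSne).1 h2
      refine hy (Metric.mem_closedBall.2 ?_)
      have h3 := Metric.mem_closedBall.1 (hR₁ hz)
      linarith [dist_triangle y z 0]
    exact ⟨Real.smoothTransition.zero_of_nonpos h1,
      Real.deriv_smoothTransition_eq_zero fun h => absurd h.1 (not_lt.2 h1)⟩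
  have hcs : ∀ τ, HasCompactSupport (φ τ) ∧ HasCompactSupport (k τ) := fun τ =>
    ⟨HasCompactSupport.intro (isCompact_closedBall 0 (R₁ + 3 + V * (τ - s)))
      fun y hy => (hsupp τ _ le_rfl y hy).1,
     HasCompactSupport.intro (isCompact_closedBall 0 (R₁ + 3 + V * (τ - s)))
      fun y hy => (hsupp τ _ le_rfl y hy).2⟩
  have iφ : ∀ τ (f : EuclideanSpace ℝ (Fin d) → ℝ), Continuous f → Integrable fun y => f y * φ τ y :=
    fun τ f hf => (hf.mul (hφc τ)).integrable_of_hasCompactSupport (hcs τ).1.mul_left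
  have ik : ∀ τ (f : EuclideanSpace ℝ (Fin d) → ℝ), Continuous f → Integrable fun y => f y * k τ y :=
    fun τ f hf => (hf.mul (hkc τ)).integrable_of_hasCompactSupport (hcs τ).2.mul_left
  have hB0 : 0 ≤ B := (abs_nonneg _).trans (hρB 0 0)
  have hM : ∀ τ, HasDerivAt (fun τ => ∫ y, ρ τ y * φ τ y)
      (∫ y, (ρ' τ y * φ τ y + ρ τ y * (k τ y * V))) τ := by
    intro τ
    -- The supports grow with time, so a single ball works for all `σ < τ + 1`, giving a uniform
    -- dominating function.
    set R := R₁ + 3 + V * (τ + 1 - s) with hR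
    refine (hasDerivAt_integral_of_dominated_loc_of_deriv_le (s := Set.Iio (τ + 1))
      (F := fun τ y => ρ τ y * φ τ y)
      (F' := fun τ y => ρ' τ y * φ τ y + ρ τ y * (k τ y * V))
      (bound := (Metric.closedBall 0 R).indicator fun _ => B * 1 + B * (c * V))
      (Iio_mem_nhds (by linarith))
      (Filter.Eventually.of_forall fun τ => (iφ τ _ (hρc τ)).1) (iφ τ _ (hρc τ)) ?_ ?_ ?_ ?_).2
    · exact (((hρ'c τ).mul (hφc τ)).add
        ((hρc τ).mul ((hkc τ).mul continuous_const))).aestronglyMeasurable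
    · refine Filter.Eventually.of_forall fun y σ hσ => ?_
      by_cases hy : y ∈ Metric.closedBall 0 R
      · rw [Set.indicator_of_mem hy]
        refine (norm_add_le _ _).trans ?_
        rw [norm_mul, norm_mul, norm_mul, Real.norm_of_nonneg hV]
        refine add_le_add (mul_le_mul (hρ'B _ _) ?_ (norm_nonneg _) hB0)
          (mul_le_mul (hρB _ _) (mul_le_mul_of_nonneg_right (hc _) hV) (by positivity) hB0)
        rw [Real.norm_of_nonneg (Real.smoothTransition.nonneg _)]
        exact Real.smoothTransition.le_one _
      · rw [Set.indicator_of_notMem hy]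
        have hσ' : σ < τ + 1 := hσ
        have h := hsupp σ R (by
          rw [hR]
          have : V * (σ - s) ≤ V * (τ + 1 - s) := mul_le_mul_of_nonneg_left (by linarith) hV
          linarith) y hy
        simp [h.1, h.2]
    · refine (integrable_indicator_iff Metric.isClosed_closedBall.measurableSet).2 ?_
      exact integrableOn_const (isCompact_closedBall _ _).measure_lt_top.ne
    · exact Filter.Eventually.of_forall fun y σ _ => (hρd σ y).mul (hφt σ y)
  have hnonneg : ∀ τ, 0 ≤ ∫ y, (ρ' τ y * φ τ y + ρ τ y * (k τ y * V)) := by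
    intro τ
    have hfd : ∀ j, Continuous fun y => fderiv ℝ g y (e j) := fun j =>
      (hg.continuous_fderiv one_ne_zero).clm_apply continuous_const
    have hparts : ∀ j, ∫ y, J' j τ y * φ τ y = ∫ y, J j τ y * fderiv ℝ g y (e j) * k τ y := by
      intro j
      have hi : ∀ y, J j τ y * -(k τ y * fderiv ℝ g y (e j)) =
          -(J j τ y * fderiv ℝ g y (e j) * k τ y) := fun y => by ring
      have h := integral_bilinear_hasLineDerivAt_right_eq_neg_left_of_integrable (μ := volume)
        (f := J j τ) (f' := J' j τ) (g := φ τ) (g' := fun y => -(k τ y * fderiv ℝ g y (e j)))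
        (v := e j) (B := ContinuousLinearMap.mul ℝ ℝ) (iφ τ _ (hJ'c j τ))
        (by
          simp only [ContinuousLinearMap.mul_apply', hi]
          exact (ik τ _ ((hJc j τ).mul (hfd j))).neg)
        (iφ τ _ (hJc j τ)) (fun y _ => hJd j τ y) (fun y _ => hφx j τ y)
      simp only [ContinuousLinearMap.mul_apply', hi, integral_neg] at h
      linarith
    have i1 : Integrable fun y => ρ τ y * (k τ y * V) := by
      simp_rw [← mul_assoc]
      exact (ik τ _ (hρc τ)).mul_const V
    rw [integral_add (iφ τ _ (hρ'c τ)) i1]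
    have h1 : ∫ y, ρ' τ y * φ τ y = -∑ j, ∫ y, J j τ y * fderiv ℝ g y (e j) * k τ y := by
      simp_rw [hdiv, neg_mul, Finset.sum_mul]
      rw [integral_neg, integral_finsetSum _ fun j _ => iφ τ _ (hJ'c j τ)]
      simp_rw [hparts]
    have iJ : ∀ j, Integrable fun y => J j τ y * fderiv ℝ g y (e j) * k τ y := fun j =>
      ik τ _ ((hJc j τ).mul (hfd j))
    -- What the current carries through the front is at most `∑ |Jⱼ| k`, as `|∂ⱼg| ≤ 1`, while the
    -- front sweeps up `V ρ k`; `hJV` compares the two.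
    rw [h1, ← integral_finsetSum _ fun j _ => iJ j, neg_add_eq_sub, sub_nonneg]
    refine integral_mono (integrable_finsetSum _ fun j _ => iJ j) i1 fun y => ?_
    simp only
    have h2 : ∀ j, J j τ y * fderiv ℝ g y (e j) ≤ |J j τ y| := by
      intro j
      refine (le_abs_self _).trans ?_
      rw [abs_mul]
      refine mul_le_of_le_one_right (abs_nonneg _) ?_
      refine ((fderiv ℝ g y).le_opNorm (e j)).trans ?_
      rw [e.norm_eq_one j, mul_one]
      exact hgd y
    calc ∑ j, J j τ y * fderiv ℝ g y (e j) * k τ y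
        ≤ ∑ j, |J j τ y| * k τ y :=
          Finset.sum_le_sum fun j _ => mul_le_mul_of_nonneg_right (h2 j) (hk0 τ y)
      _ = (∑ j, |J j τ y|) * k τ y := (Finset.sum_mul _ _ _).symm
      _ ≤ V * ρ τ y * k τ y := mul_le_mul_of_nonneg_right (hJV τ y) (hk0 τ y)
      _ = ρ τ y * (k τ y * V) := by ring
  have hmono : Monotone fun τ => ∫ y, ρ τ y * φ τ y :=
    monotone_of_deriv_nonneg (fun τ => (hM τ).differentiableAt) fun τ => by
      rw [(hM τ).deriv]; exact hnonneg τ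
  calc ∫ y in S, ρ s y = ∫ y, S.indicator (ρ s) y := (integral_indicator hSm).symm
    _ ≤ ∫ y, ρ s y * φ s y := by
        refine integral_mono_of_nonneg
          (Filter.Eventually.of_forall fun y => Set.indicator_nonneg (fun y _ => hρ0 s y) y)
          (iφ s _ (hρc s)) (Filter.Eventually.of_forall fun y => ?_)
        by_cases hy : y ∈ S
        · simp only [Set.indicator_of_mem hy]
          have : φ s y = 1 := Real.smoothTransition.one_of_one_le (by
            simp only [hθ]
            linarith [hgS y hy])
          rw [this, mul_one]
        · simp only [Set.indicator_of_notMem hy]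
          exact mul_nonneg (hρ0 s y) (Real.smoothTransition.nonneg _)
    _ ≤ ∫ y, ρ t y * φ t y := hmono hst
    _ ≤ ∫ y, (Metric.thickening L S).indicator (ρ t) y := by
        refine integral_mono (iφ t _ (hρc t)) ?_ fun y => ?_
        · refine (integrable_indicator_iff Metric.isOpen_thickening.measurableSet).2 ?_
          exact ((hρc t).locallyIntegrable.integrableOn_isCompact
            (hS.thickening.isCompact_closure)).mono_set subset_closure
        · by_cases hy : y ∈ Metric.thickening L S
          · simp only [Set.indicator_of_mem hy]
            exact mul_le_of_le_one_right (hρ0 t y) (Real.smoothTransition.le_one _)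
          · simp only [Set.indicator_of_notMem hy]
            have : φ t y = 0 := Real.smoothTransition.zero_of_nonpos (by
              -- Outside the thickening `g ≥ L - 2 ≥ 1 + V(t - s)`, which is where the 3 in `hL`
              -- comes from.
              have h1 : L ≤ Metric.infDist y S := by
                by_contra! h
                exact hy (by
                  rw [Metric.mem_thickening_iff]
                  exact (Metric.infDist_lt_iff hSne).1 h)
              simp only [hθ]
              linarith [hgD y])
            rw [this, mul_zero]
    _ = ∫ y in Metric.thickening L S, ρ t y :=
        integral_indicator Metric.isOpen_thickening.measurableSet

end FiniteSpeed

/-! ### The unit cube grid -/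

section Cubes

variable {d : ℕ}

/-- The index of the unit cube of the integer grid containing `x`. -/
noncomputable def cubeIndex (x : EuclideanSpace ℝ (Fin d)) : Fin d → ℤ := fun i => ⌊x i⌋

/-- The corner of a unit cube of the integer grid. -/
noncomputable def cubeCorner (n : Fin d → ℤ) : EuclideanSpace ℝ (Fin d) :=
  WithLp.toLp 2 fun i => (n i : ℝ)

theorem measurableSet_preimage_cubeIndex (F : Set (Fin d → ℤ)) :
    MeasurableSet ((cubeIndex (d := d)) ⁻¹' F) := by
  have h : Measurable (cubeIndex (d := d)) := by
    refine measurable_pi_iff.2 fun i => ?_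
    exact Int.measurable_floor.comp (by fun_prop)
  exact h F.to_countable.measurableSet

theorem dist_cubeCorner_cubeIndex_le (x : EuclideanSpace ℝ (Fin d)) :
    dist x (cubeCorner (cubeIndex x)) ≤ Real.sqrt d := by
  rw [EuclideanSpace.dist_eq]
  refine Real.sqrt_le_sqrt ?_
  refine (Finset.sum_le_card_nsmul _ _ 1 fun i _ => ?_).trans_eq (by simp)
  have h : x i - cubeCorner (cubeIndex x) i = Int.fract (x i) := rfl
  rw [Real.dist_eq, h, sq_abs]
  nlinarith [Int.fract_nonneg (x i), Int.fract_lt_one (x i)]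

theorem finite_setOf_dist_cubeCorner_le (x : EuclideanSpace ℝ (Fin d)) (r : ℝ) :
    {n : Fin d → ℤ | dist x (cubeCorner n) ≤ r}.Finite := by
  refine (Set.finite_Icc (fun i => ⌊x i - r⌋) fun i => ⌈x i + r⌉).subset fun n hn => ?_
  have h : ∀ i, |x i - n i| ≤ r := by
    intro i
    have h1 : dist x (cubeCorner n) ≤ r := hn
    rw [EuclideanSpace.dist_eq] at h1
    refine le_trans ?_ h1
    refine Real.le_sqrt_of_sq_le ?_
    have h2 := Finset.single_le_sum (f := fun i => dist (x i) (cubeCorner n i) ^ 2)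
      (fun i _ => sq_nonneg _) (Finset.mem_univ i)
    simpa [Real.dist_eq, cubeCorner] using h2
  constructor
  · intro i
    have := abs_le.1 (h i)
    have h1 : (⌊x i - r⌋ : ℝ) ≤ n i := (Int.floor_le _).trans (by linarith)
    exact_mod_cast h1
  · intro i
    have := abs_le.1 (h i)
    have h1 : (n i : ℝ) ≤ ⌈x i + r⌉ := le_trans (by linarith) (Int.le_ceil _)
    exact_mod_cast h1

theorem isBounded_preimage_cubeIndex (F : Finset (Fin d → ℤ)) :
    Bornology.IsBounded ((cubeIndex (d := d)) ⁻¹' F) := by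
  refine (((Bornology.isBounded_biUnion_finset F).2 fun n _ =>
    Metric.isBounded_closedBall (x := cubeCorner n) (r := Real.sqrt d))).subset fun x hx => ?_
  exact Set.mem_biUnion hx (Metric.mem_closedBall.2 (dist_cubeCorner_cubeIndex_le x))

variable {ρ : EuclideanSpace ℝ (Fin d) → ℝ}

theorem Continuous.integrableOn_of_isBounded (hρ : Continuous ρ)
    {S : Set (EuclideanSpace ℝ (Fin d))} (hS : Bornology.IsBounded S) : IntegrableOn ρ S :=
  (hρ.locallyIntegrable.integrableOn_isCompact hS.isCompact_closure).mono_set subset_closure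

theorem setIntegral_preimage_cubeIndex (hρ : Continuous ρ) (F : Finset (Fin d → ℤ)) :
    ∫ y in (cubeIndex (d := d)) ⁻¹' F, ρ y = ∑ n ∈ F, ∫ y in cubeIndex ⁻¹' {n}, ρ y := by
  have h : (cubeIndex (d := d)) ⁻¹' F = ⋃ n ∈ F, cubeIndex ⁻¹' {n} := by
    ext x; simp
  rw [h, integral_biUnion_finset F (fun n _ => measurableSet_preimage_cubeIndex _) ?_ fun n _ => ?_]
  · intro m _ n _ hmn
    exact Disjoint.preimage _ (by simpa using hmn)
  · exact hρ.integrableOn_of_isBounded (by simpa using isBounded_preimage_cubeIndex {n})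

theorem setIntegral_le_sum_cubes (hρ : Continuous ρ) (h0 : ∀ y, 0 ≤ ρ y)
    {S : Set (EuclideanSpace ℝ (Fin d))} {F : Finset (Fin d → ℤ)} (hS : S ⊆ cubeIndex ⁻¹' F) :
    ∫ y in S, ρ y ≤ ∑ n ∈ F, ∫ y in cubeIndex ⁻¹' {n}, ρ y := by
  rw [← setIntegral_preimage_cubeIndex hρ]
  exact setIntegral_mono_set (hρ.integrableOn_of_isBounded (isBounded_preimage_cubeIndex F))
    (Filter.Eventually.of_forall h0) hS.eventuallyLE

theorem tsum_ofReal_setIntegral_cubes (hρ : Continuous ρ) (h0 : ∀ y, 0 ≤ ρ y) :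
    ∑' n : Fin d → ℤ, ENNReal.ofReal (∫ y in cubeIndex ⁻¹' {n}, ρ y) =
      ∫⁻ y, ENNReal.ofReal (ρ y) := by
  have h1 : ∀ n : Fin d → ℤ, ENNReal.ofReal (∫ y in cubeIndex ⁻¹' {n}, ρ y) =
      ∫⁻ y in cubeIndex ⁻¹' {n}, ENNReal.ofReal (ρ y) := fun n =>
    ofReal_integral_eq_lintegral_ofReal
      (hρ.integrableOn_of_isBounded (by simpa using isBounded_preimage_cubeIndex {n}))
      (Filter.Eventually.of_forall h0)
  simp_rw [h1]
  have h2 : ⋃ n : Fin d → ℤ, cubeIndex ⁻¹' {n} = (Set.univ : Set (EuclideanSpace ℝ (Fin d))) := by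
    ext x; simp
  rw [← lintegral_iUnion (fun n => measurableSet_preimage_cubeIndex _), h2, setLIntegral_univ]
  · intro m n hmn
    exact Disjoint.preimage _ (by simpa using hmn)

end Cubes

/-! ### Transport between cubes and construction of the tubes -/

section Tubes

variable {d : ℕ}

open scoped ENNReal in
/-- A density of constant mass with finite speed of propagation is carried by a countable weighted
family of paths of bounded speed. -/
theorem exists_weighted_tubes {ρ : ℝ → EuclideanSpace ℝ (Fin d) → ℝ} {c L m : ℝ}
    (hc : ∀ t, |deriv Real.smoothTransition t| ≤ c) (hL : 0 ≤ L)
    (hρc : ∀ t, Continuous (ρ t)) (hρ0 : ∀ t y, 0 ≤ ρ t y)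
    (hspeed : ∀ s t, s ≤ t → t ≤ s + 1 → ∀ S : Set (EuclideanSpace ℝ (Fin d)),
      Bornology.IsBounded S → MeasurableSet S →
      ∫ y in S, ρ s y ≤ ∫ y in Metric.thickening L S, ρ t y)
    (hmass : ∀ t, ∫⁻ y, ENNReal.ofReal (ρ t y) = ENNReal.ofReal m) (R : ℝ) :
    ∃ (κ : Type) (_ : Countable κ) (γ : κ → ℝ → EuclideanSpace ℝ (Fin d)) (W : κ → ℝ≥0∞),
      (∀ i, IsPathOfSpeedAtMost (γ i) (c * (L + 2 * Real.sqrt d))) ∧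
      ∑' i, W i = ENNReal.ofReal m ∧
      ∀ x, ∀ t ∈ Set.Icc (-R) R, ENNReal.ofReal (∫ y in Metric.closedBall x 1, ρ t y) ≤
        ∑' i, {i | ‖x - γ i t‖ ≤ 2 * L + 3 * Real.sqrt d + 1}.indicator W i := by
  classical
  set D := Real.sqrt d with hD
  have hD0 : 0 ≤ D := Real.sqrt_nonneg _
  set q : ℕ → (Fin d → ℤ) → ℝ := fun k n => ∫ y in cubeIndex ⁻¹' {n}, ρ (-R + k) y with hq
  have hq0 : ∀ k n, 0 ≤ q k n := fun k n => integral_nonneg fun y => hρ0 _ y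
  -- Two points at distance less than `L` have cube corners within `L + 2√d`, each point being
  -- within `√d` of its corner.
  set N : (Fin d → ℤ) → Finset (Fin d → ℤ) := fun n =>
    (finite_setOf_dist_cubeCorner_le (cubeCorner n) (L + 2 * D)).toFinset with hN
  have hNmem : ∀ n n', n' ∈ N n ↔ dist (cubeCorner n) (cubeCorner n') ≤ L + 2 * D := by
    intro n n'
    simp [hN]
  -- Finite speed for the union of the cubes in `A` is Hall's condition.
  have hall : ∀ k (A : Finset (Fin d → ℤ)), ∑ n ∈ A, q k n ≤ ∑ n ∈ A.biUnion N, q (k + 1) n := by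
    intro k A
    simp only [hq]
    rw [← setIntegral_preimage_cubeIndex (hρc _)]
    refine (hspeed _ (-R + ((k + 1 : ℕ) : ℝ)) (by push_cast; linarith) (by push_cast; linarith) _
      (isBounded_preimage_cubeIndex A) (measurableSet_preimage_cubeIndex _)).trans ?_
    refine setIntegral_le_sum_cubes (hρc _) (hρ0 _) fun x hx => ?_
    obtain ⟨z, hz, hxz⟩ := Metric.mem_thickening_iff.1 hx
    refine Finset.mem_coe.2 (Finset.mem_biUnion.2 ⟨cubeIndex z, hz, (hNmem _ _).2 ?_⟩)
    have h1 := dist_cubeCorner_cubeIndex_le x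
    have h2 := dist_cubeCorner_cubeIndex_le z
    rw [dist_comm] at h2
    rw [dist_comm] at hxz
    linarith [dist_triangle4 (cubeCorner (cubeIndex z)) z x (cubeCorner (cubeIndex x))]
  have htot : ∀ k, ∑' n, ENNReal.ofReal (q k n) = ENNReal.ofReal m := fun k =>
    (tsum_ofReal_setIntegral_cubes (hρc _) (hρ0 _)).trans (hmass _)
  choose π hπ0 hπrow hπcol using fun k => exists_coupling (q k) (q (k + 1)) (hq0 k) (hq0 (k + 1)) N
    (hall k) ((htot k).trans (htot (k + 1)).symm) ((htot k).trans_ne ENNReal.ofReal_ne_top)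
  -- The unit steps starting at `k ≤ ⌊2R⌋₊` cover `[0, 2R]`, the time window shifted by `R`; the
  -- marginal at the end of the last step is needed as well.
  obtain ⟨κ, hκ, p, W, hp, hW⟩ := exists_weighted_paths (fun n n' => n' ∈ N n)
    (fun n => (hNmem n n).2 (by rw [dist_self]; positivity)) (fun k n => ENNReal.ofReal (q k n))
    (fun _ _ => ENNReal.ofReal_ne_top) π hπ0 hπrow hπcol (⌊2 * R⌋₊ + 1)
  have hstep : ∀ i k, ‖cubeCorner (p i (k + 1)) - cubeCorner (p i k)‖ ≤ L + 2 * D := by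
    intro i k
    rw [← dist_eq_norm, dist_comm]
    exact (hNmem _ _).1 (hp i k)
  choose γ hγd hγs hγ using fun i => exists_differentiable_interpolation hc
    (fun k => cubeCorner (p i k)) (hstep i) (⌊2 * R⌋₊ + 1)
  refine ⟨κ, hκ, fun i t => γ i (t + R), W, fun i => ⟨?_, fun t => ?_⟩, ?_, ?_⟩
  · exact (hγd i).comp (differentiable_id.add_const R)
  · rw [deriv_comp_add_const]
    exact hγs i _
  · rw [← htot 0]
    have h1 : ∀ i, W i = ∑' n, {i | p i 0 = n}.indicator W i := by
      intro i
      rw [tsum_eq_single (p i 0)]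
      · simp
      · intro n hn
        simp [hn.symm]
    rw [tsum_congr h1, ENNReal.tsum_comm]
    exact tsum_congr fun n => hW 0 (Nat.zero_le _) n
  · intro x t ht
    set k := ⌊t + R⌋₊ with hk
    have ht0 : 0 ≤ t + R := by linarith [ht.1]
    have hk1 : (k : ℝ) ≤ t + R := Nat.floor_le ht0
    have hk2 : t + R < k + 1 := Nat.lt_floor_add_one _
    have hkN : k < ⌊2 * R⌋₊ + 1 := Nat.lt_succ_of_le (Nat.floor_le_floor (by linarith [ht.2]))
    set F := (finite_setOf_dist_cubeCorner_le x (1 + L + D)).toFinset with hF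
    -- Between grid times the ball's mass is pushed forward to the next grid time, where the
    -- marginals of the paths are known.
    have h1 : ∫ y in Metric.closedBall x 1, ρ t y ≤ ∑ n ∈ F, q (k + 1) n := by
      refine (hspeed t (-R + ((k + 1 : ℕ) : ℝ)) (by push_cast; linarith) (by push_cast; linarith) _
        Metric.isBounded_closedBall Metric.isClosed_closedBall.measurableSet).trans ?_
      refine setIntegral_le_sum_cubes (hρc _) (hρ0 _) fun z hz => ?_
      obtain ⟨z', hz', hzz'⟩ := Metric.mem_thickening_iff.1 hz
      simp only [hF, Set.Finite.coe_toFinset, Set.mem_preimage]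
      change dist x _ ≤ 1 + L + D
      have h2 := dist_cubeCorner_cubeIndex_le z
      rw [Metric.mem_closedBall, dist_comm] at hz'
      rw [dist_comm] at hzz'
      linarith [dist_triangle4 x z' z (cubeCorner (cubeIndex z))]
    refine (ENNReal.ofReal_le_ofReal h1).trans ?_
    rw [ENNReal.ofReal_sum_of_nonneg fun n _ => hq0 (k + 1) n,
      Finset.sum_congr rfl fun n _ => (hW (k + 1) hkN n).symm,
      ← Summable.tsum_finsetSum fun n _ => ENNReal.summable]
    refine ENNReal.tsum_le_tsum fun i => ?_
    by_cases hi : p i (k + 1) ∈ F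
    · rw [Finset.sum_eq_single_of_mem (p i (k + 1)) hi
        (fun n _ hn => by simp [hn.symm])]
      -- Sum of `1 + L + √d`, from `x` to the corner at the next grid time, and `L + 2√d`, the
      -- displacement along the path during one step.
      have h2 : ‖x - γ i (t + R)‖ ≤ 2 * L + 3 * D + 1 := by
        have h3 := hγ i k hkN (t + R) ⟨hk1, hk2.le⟩
        have h4 : dist x (cubeCorner (p i (k + 1))) ≤ 1 + L + D := by
          simpa [hF] using hi
        rw [← dist_eq_norm] at h3 ⊢
        rw [dist_comm] at h3
        linarith [dist_triangle x (cubeCorner (p i (k + 1))) (γ i (t + R))]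
      rw [Set.indicator_of_mem (show i ∈ {i | ‖x - γ i (t + R)‖ ≤ 2 * L + 3 * D + 1} from h2)]
      exact Set.indicator_le_self _ _ _
    · rw [Finset.sum_eq_zero]
      · exact zero_le
      · intro n hn
        refine Set.indicator_of_notMem ?_ _
        rintro rfl
        exact hi hn

/-- Finite speed of propagation for the averaged density of a wave. -/
theorem exists_waveDensity_finite_speed (d : ℕ) :
    ∃ L : ℝ, 0 ≤ L ∧ ∀ a : EuclideanSpace ℝ (Fin d) → ℂ, IsProfile a → ∀ s t, s ≤ t → t ≤ s + 1 →
      ∀ S : Set (EuclideanSpace ℝ (Fin d)), Bornology.IsBounded S → MeasurableSet S →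
      ∫ y in S, waveDensity a s y ≤ ∫ y in Metric.thickening L S, waveDensity a t y := by
  obtain ⟨V, C, hV, -, hVC⟩ := exists_waveDensity_bounds d
  refine ⟨3 + V, by positivity, fun a ha s t hst hts S hS hSm => ?_⟩
  -- `Metric.infDist` to the empty set is 0, so the moving front only makes sense for nonempty `S`.
  rcases S.eq_empty_or_nonempty with rfl | hSne
  · simp
  have hρB : ∀ t y, |waveDensity a t y| ≤ _ := fun t y =>
    abs_slowAverage_le (abs_norm_wave_sq_le a t) y
  have hρ'B := fun t y => abs_slowAverage_le
    (abs_two_mul_re_le a (profileTimeDeriv a) t) y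
  refine integral_le_of_continuity_equation hV.le
    (continuous_waveDensity ha)
    (fun t => continuous_slowAverage (continuous_two_mul_re ha ha.profileTimeDeriv t)
      (abs_two_mul_re_le a _ t))
    (fun j t => continuous_slowAverage (continuous_two_mul_im ha (ha.profileDeriv _) t)
      (abs_two_mul_im_le a _ t))
    (fun j t => continuous_slowAverage
      (continuous_two_mul_im ha ((ha.profileDeriv (EuclideanSpace.basisFun (Fin d) ℝ j)).profileDeriv
        (EuclideanSpace.basisFun (Fin d) ℝ j)) t) (abs_two_mul_im_le a _ t))
    (waveDensity_nonneg a)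
    (fun t y => (hρB t y).trans (le_max_left _ _)) (fun t y => (hρ'B t y).trans (le_max_right _ _))
    (hasDerivAt_waveDensity ha) (fun j t y => hasLineDerivAt_waveCurrent ha _ t y)
    (slowAverage_continuity_equation ha) (fun t y => (hVC a ha t y).1) hS hSm hSne hst
    (by nlinarith)

/-- Mass in a unit ball controls the pointwise density of a wave. -/
theorem exists_norm_wave_sq_le_setIntegral (d : ℕ) :
    ∃ C : ℝ, 0 < C ∧ ∀ a : EuclideanSpace ℝ (Fin d) → ℂ, IsProfile a → ∀ t x,
      ‖wave a t x‖ ^ 2 ≤ C * ∫ y in Metric.closedBall x 1, waveDensity a t y := by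
  obtain ⟨V, C, -, hC, hVC⟩ := exists_waveDensity_bounds d
  set v := volume.real (Metric.closedBall (0 : EuclideanSpace ℝ (Fin d)) 1) with hv
  have hv0 : 0 < v := ENNReal.toReal_pos (Metric.measure_closedBall_pos volume _ one_pos).ne'
    (isCompact_closedBall _ _).measure_lt_top.ne
  refine ⟨C * 2 ^ (d + 1) / v, by positivity, fun a ha t x => ?_⟩
  have hρc := continuous_waveDensity ha t
  -- The averaged density varies by a factor at most `2^(d+1)` on a unit ball, so its value at the
  -- centre is controlled by its mass there.
  have h1 : waveDensity a t x * v ≤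
      2 ^ (d + 1) * ∫ y in Metric.closedBall x 1, waveDensity a t y := by
    have h2 : ∫ _ in Metric.closedBall x 1, waveDensity a t x = waveDensity a t x * v := by
      rw [setIntegral_const, smul_eq_mul, mul_comm, hv, measureReal_def, measureReal_def,
        Measure.addHaar_closedBall_center]
    rw [← h2, ← integral_const_mul]
    refine setIntegral_mono_on (integrableOn_const (isCompact_closedBall _ _).measure_lt_top.ne)
      ((hρc.integrableOn_of_isBounded Metric.isBounded_closedBall).const_mul _)
      Metric.isClosed_closedBall.measurableSet fun y hy => ?_
    exact slowAverage_le_of_dist_le (continuous_norm_wave_sq ha t)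
      (abs_norm_wave_sq_le a t) (fun _ => sq_nonneg _) (by rwa [dist_comm])
  refine (hVC a ha t x).2.trans ?_
  rw [div_mul_eq_mul_div, le_div_iff₀ hv0]
  nlinarith

end Tubes

/-! ### Assembly of the theorem -/

theorem theorem1 (d : ℕ) :
    ∃ r V C : ℝ, 0 < r ∧ 0 < V ∧ 0 < C ∧
      ∀ (u : ℝ → EuclideanSpace ℝ (Fin d) → ℂ) (hu : IsSchrodingerSolution u),
        (∀ t : ℝ, Continuous (u t)) →
        HasFourierSupportIn (u 0) (hu.memLp 0) (Metric.closedBall 0 1) →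
        ∀ R : ℝ, 0 < R →
          ∃ (γ : ℕ → ℝ → EuclideanSpace ℝ (Fin d)) (w : ℕ → ℝ),
            (∀ i, IsPathOfSpeedAtMost (γ i) V) ∧
            (∀ i, 0 ≤ w i) ∧
            Summable w ∧
            (∀ (x : EuclideanSpace ℝ (Fin d)) (t : ℝ), t ∈ Set.Icc (-R) R →
              ‖u t x‖ ^ 2 ≤ ∑' i, w i * (tube (γ i) r).indicator 1 (x, t)) ∧
            ∀ t : ℝ, ∑' i, r ^ d * w i ≤ C * ∫ x, ‖u t x‖ ^ 2 := by
  obtain ⟨c, hc0, hc⟩ := Real.exists_abs_deriv_smoothTransition_le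
  obtain ⟨L, hL, hspeed⟩ := exists_waveDensity_finite_speed d
  obtain ⟨C, hC0, hC⟩ := exists_norm_wave_sq_le_setIntegral d
  set K := ∫ z, slowKernel (d := d) z with hK
  have hK0 : 0 ≤ K := integral_nonneg fun z => (slowKernel_pos z).le
  set r := 2 * L + 3 * Real.sqrt d + 1 with hr
  have hr0 : 0 < r := by positivity
  -- The two `+ 1` only secure strict positivity, as `L`, `√d` and `K` are merely known to be
  -- nonnegative here. The weights are `C W i`, of total `C K M`.
  refine ⟨r, c * (L + 2 * Real.sqrt d) + 1, r ^ d * (C * (K + 1)), hr0, by positivity,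
    by positivity, fun u hu hcont hsupp R hR => ?_⟩
  obtain ⟨a, ha, hua⟩ := hu.exists_eq_wave hcont hsupp
  have hwu : ∀ t, wave a t = u t := fun t => funext fun x => (hua t x).symm
  set M := ∫ x, ‖u 0 x‖ ^ 2 with hM
  have hM0 : 0 ≤ M := integral_nonneg fun x => by positivity
  have hmass : ∀ t, ∫⁻ y, ENNReal.ofReal (waveDensity a t y) = ENNReal.ofReal (K * M) := by
    intro t
    unfold waveDensity
    rw [lintegral_slowAverage (continuous_norm_wave_sq ha t) (abs_norm_wave_sq_le a t)
      (fun _ => sq_nonneg _) (by rw [hwu]; exact (hu.memLp t).integrable_norm_pow two_ne_zero)]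
    simp_rw [hwu]
    rw [hu.integral_norm_sq_eq t]
  obtain ⟨κ, hκ, γ, W, hγ, hW, hcov⟩ := exists_weighted_tubes hc hL
    (continuous_waveDensity ha) (waveDensity_nonneg a) (hspeed a ha) hmass R
  obtain ⟨e, he⟩ := exists_injective_nat κ
  have hWtop : ∑' i, W i ≠ ⊤ := hW ▸ ENNReal.ofReal_ne_top
  have hWi : ∀ i, W i ≠ ⊤ := ENNReal.ne_top_of_tsum_ne_top hWtop
  have hsum : HasSum (fun i => C * (W i).toReal) (C * (K * M)) := by
    have h := (ENNReal.hasSum_toReal hWtop).mul_left C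
    rwa [← ENNReal.tsum_toReal_eq hWi, hW, ENNReal.toReal_ofReal (by positivity)] at h
  have hsum' := (hasSum_extend_zero he).2 hsum
  -- The countable index type is embedded in `ℕ`; unused indices get the constant path at the origin
  -- and weight zero.
  refine ⟨Function.extend e γ 0, Function.extend e (fun i => C * (W i).toReal) 0, fun n => ?_,
    fun n => ?_, hsum'.summable, fun x t ht => ?_, fun t => ?_⟩
  · by_cases hn : ∃ i, e i = n
    · obtain ⟨i, rfl⟩ := hn
      rw [he.extend_apply]
      exact ⟨(hγ i).1, fun t => ((hγ i).2 t).trans (by linarith)⟩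
    · rw [Function.extend_apply' _ _ _ hn]
      refine ⟨differentiable_const 0, fun t => ?_⟩
      have : deriv (0 : ℝ → EuclideanSpace ℝ (Fin d)) t = 0 := deriv_const t 0
      rw [Pi.zero_apply, this, norm_zero]
      positivity
  · by_cases hn : ∃ i, e i = n
    · obtain ⟨i, rfl⟩ := hn
      rw [he.extend_apply]
      positivity
    · rw [Function.extend_apply' _ _ _ hn]
      exact le_rfl
  · have h1 : (fun n => Function.extend e (fun i => C * (W i).toReal) 0 n *
        (tube (Function.extend e γ 0 n) r).indicator (1 : _ × ℝ → ℝ) (x, t)) =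
        Function.extend e (fun i => C * ({i | ‖x - γ i t‖ ≤ r}.indicator W i).toReal) 0 := by
      funext n
      by_cases hn : ∃ i, e i = n
      · obtain ⟨i, rfl⟩ := hn
        rw [he.extend_apply, he.extend_apply, he.extend_apply]
        by_cases hi : ‖x - γ i t‖ ≤ r
        · simp [tube, Set.indicator, hi]
        · simp [tube, Set.indicator, hi]
      · rw [Function.extend_apply' _ _ _ hn, Function.extend_apply' _ _ _ hn,
          Function.extend_apply' _ _ _ hn]
        simp
    rw [h1, tsum_extend_zero he, tsum_mul_left]
    have h2 : ∀ i, {i | ‖x - γ i t‖ ≤ r}.indicator W i ≤ W i := Set.indicator_le_self _ _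
    rw [← ENNReal.tsum_toReal_eq fun i => ne_top_of_le_ne_top (hWi i) (h2 i), hua]
    refine (hC a ha t x).trans (mul_le_mul_of_nonneg_left ?_ hC0.le)
    exact (ENNReal.ofReal_le_iff_le_toReal
      (ne_top_of_le_ne_top hWtop (ENNReal.tsum_le_tsum h2))).1 (hcov x t ht)
  · rw [tsum_mul_left, hsum'.tsum_eq, hu.integral_norm_sq_eq t, mul_assoc, mul_assoc]
    refine mul_le_mul_of_nonneg_left (mul_le_mul_of_nonneg_left ?_ hC0.le) (by positivity)
    linarith
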